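/- \textbf{Setting.} Let $n,p,K\ge 1$ be integers. Each worker $i\in\{1,\dots,n\}$ has a given type $k_i\in\{1,\dots,K\}$ and each firm $j\in\{1,\dots,p\}$ a given type $\ell_j\in\{1,\dots,K\}$; let $n_k$ be the number of workers of type $k$, and assume $n_k\ge1$ for all $k$. Let $C=(C(k,\ell))$ be a $K\times K$ matrix with nonnegative entries, $C(k,\cdot)=\sum_\ell C(k,\ell)$, $C(\cdot,\ell)=\sum_k C(k,\ell)$, and let $\theta_1,\dots,\theta_p\ge0$ satisfy $\sum_{j:\ell_j=\ell}\theta_j=1$ for every type $\ell$. Assume $p_{ij}:=\frac1{n_{k_i}}\theta_jC(k_i,\ell_j)\le 1$ for all $i,j$. Let $B=(d_{ij})$ be a random $n\times p$ matrix whose entries are independent, with $d_{ij}$ Bernoulli of parameter $p_{ij}$, and let $\mathfrak B=\mathbb E B=(p_{ij})$. For $\lambda_w,\lambda_f\ge0$ put $D_{w,\lambda}=\mathrm{diag}(\sum_jd_{ij}+\lambda_w)_i$, $D_{f,\lambda}=\mathrm{diag}(\sum_id_{ij}+\lambda_f)_j$, \[ \widetilde L_{f,\lambda}=D_{f,\lambda}-B^\top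 D_{w,\lambda}^{-1}B,\qquad \widetilde L_{w,\lambda}=D_{w,\lambda}-BD_{f,\lambda}^{-1}B^\top, \] \[ L_{f,\lambda}=I_p-D_{f,\lambda}^{-1/2}B^\top D_{w,\lambda}^{-1}BD_{f,\lambda}^{-1/2},\qquad L_{w,\lambda}=I_n-D_{w,\lambda}^{-1/2}BD_{f,\lambda}^{-1}B^\top D_{w,\lambda}^{-1/2}, \] and let $\mathfrak D_{w,\lambda},\mathfrak D_{f,\lambda},\widetilde{\mathfrak L}_{f,\lambda},\widetilde{\mathfrak L}_{w,\lambda},\mathfrak L_{f,\lambda},\mathfrak L_{w,\lambda}$ be the same matrices formed with $\mathfrak B$ in place of $B$. Let \[ \underline\delta_w=\min_k\tfrac1{n_k}C(k,\cdot),\quad \overline\delta_w=\max_k\tfrac1{n_k}C(k,\cdot),\quad \underline\delta_f=\min_j\theta_jC(\cdot,\ell_j),\quad \overline\delta_f=\max_j\theta_jC(\cdot,\ell_j) \] be the extreme expected worker and firm degrees, assume $\underline\delta_w+\lambda_w>0$ and $\underline\delta_f+\lambda_f>0$, and put $M=\max\{(\underline\delta_w+\lambda_w)^{-1},(\underline\delta_f+\lambda_f)^{-1}\}$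 and $\gamma=p/n$. Let $\|\cdot\|$ be the spectral norm. \textbf{Theorem.} Let $\epsilon>0$ be such that $M\le\left(3\ln\frac{n+p}{\epsilon}\right)^{-1}$, and let $t=\sqrt{3M\ln\frac{n+p}{\epsilon}}$. (Firms) If $\lambda_f>0$, then $\widetilde{\mathfrak L}_{f,\lambda}$ is invertible and, with probability at least $1-\frac{3+9\gamma}{1+\gamma}\epsilon$, the matrices $D_{w,\lambda}$ and $\widetilde L_{f,\lambda}$ are invertible and \[ \left\Vert \widetilde L_{f,\lambda}^{-1}-\widetilde{\mathfrak L}_{f,\lambda}^{-1}\right\Vert=\left\Vert D_{f,\lambda}^{-1/2}L_{f,\lambda}^{-1}D_{f,\lambda}^{-1/2}-\mathfrak D_{f,\lambda}^{-1/2}\mathfrak L_{f,\lambda}^{-1}\mathfrak D_{f,\lambda}^{-1/2}\right\Vert\le\left(5+16\frac{\overline\delta_f+\lambda_f}{\underline\delta_f+\lambda_f}\right)\frac{\overline\delta_f+\lambda_f}{\lambda_f^2}\,t . \] (Workers) If $\lambda_w>0$, then $\widetilde{\mathfrak L}_{w,\lambda}$ is invertible and, with probability at least $1-\frac{8+4\gamma}{1+\gamma}\epsilon$,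 the matrices $D_{f,\lambda}$ and $\widetilde L_{w,\lambda}$ are invertible and \[ \left\Vert \widetilde L_{w,\lambda}^{-1}-\widetilde{\mathfrak L}_{w,\lambda}^{-1}\right\Vert=\left\Vert D_{w,\lambda}^{-1/2}L_{w,\lambda}^{-1}D_{w,\lambda}^{-1/2}-\mathfrak D_{w,\lambda}^{-1/2}\mathfrak L_{w,\lambda}^{-1}\mathfrak D_{w,\lambda}^{-1/2}\right\Vert\le\left(5+16\frac{\overline\delta_w+\lambda_w}{\underline\delta_w+\lambda_w}\right)\frac{\overline\delta_w+\lambda_w}{\lambda_w^2}\,t . \] -/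

import Mathlib

open MeasureTheory ProbabilityTheory
open scoped Matrix Matrix.Norms.L2Operator

noncomputable section

namespace RidgeNetwork

/-! ### Degrees and regularized Laplacians of a weighted bipartite graph

The graph is given by its `n × p` adjacency matrix `B` (workers in rows, firms in columns). -/

section Laplacians

variable {n p : ℕ}

/-- Degree of worker `i`. -/
def workerDegree (B : Matrix (Fin n) (Fin p) ℝ) (i : Fin n) : ℝ := ∑ j, B i j

/-- Degree of firm `j`. -/
def firmDegree (B : Matrix (Fin n) (Fin p) ℝ) (j : Fin p) : ℝ := ∑ i, B i j

/-- `D_{w,λ} = D_w + λ_w I_n`. -/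
def Dw (B : Matrix (Fin n) (Fin p) ℝ) (lamW : ℝ) : Matrix (Fin n) (Fin n) ℝ :=
  Matrix.diagonal fun i => workerDegree B i + lamW

/-- `D_{f,λ} = D_f + λ_f I_p`. -/
def Df (B : Matrix (Fin n) (Fin p) ℝ) (lamF : ℝ) : Matrix (Fin p) (Fin p) ℝ :=
  Matrix.diagonal fun j => firmDegree B j + lamF

/-- `D_{w,λ}^{-1/2}`. -/
def DwInvSqrt (B : Matrix (Fin n) (Fin p) ℝ) (lamW : ℝ) : Matrix (Fin n) (Fin n) ℝ :=
  Matrix.diagonal fun i => (√(workerDegree B i + lamW))⁻¹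

/-- `D_{f,λ}^{-1/2}`. -/
def DfInvSqrt (B : Matrix (Fin n) (Fin p) ℝ) (lamF : ℝ) : Matrix (Fin p) (Fin p) ℝ :=
  Matrix.diagonal fun j => (√(firmDegree B j + lamF))⁻¹

/-- The regularized un-normalized firm Laplacian `D_{f,λ} - Bᵀ D_{w,λ}⁻¹ B`. -/
def unnormLf (B : Matrix (Fin n) (Fin p) ℝ) (lamW lamF : ℝ) : Matrix (Fin p) (Fin p) ℝ :=
  Df B lamF - Bᵀ * (Dw B lamW)⁻¹ * B

/-- The regularized un-normalized worker Laplacian `D_{w,λ} - B D_{f,λ}⁻¹ Bᵀ`. -/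
def unnormLw (B : Matrix (Fin n) (Fin p) ℝ) (lamW lamF : ℝ) : Matrix (Fin n) (Fin n) ℝ :=
  Dw B lamW - B * (Df B lamF)⁻¹ * Bᵀ

/-- The regularized normalized firm Laplacian
`I_p - D_{f,λ}^{-1/2} Bᵀ D_{w,λ}⁻¹ B D_{f,λ}^{-1/2}`. -/
def normLf (B : Matrix (Fin n) (Fin p) ℝ) (lamW lamF : ℝ) : Matrix (Fin p) (Fin p) ℝ :=
  1 - DfInvSqrt B lamF * (Bᵀ * (Dw B lamW)⁻¹ * B) * DfInvSqrt B lamF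

/-- The regularized normalized worker Laplacian
`I_n - D_{w,λ}^{-1/2} B D_{f,λ}⁻¹ Bᵀ D_{w,λ}^{-1/2}`. -/
def normLw (B : Matrix (Fin n) (Fin p) ℝ) (lamW lamF : ℝ) : Matrix (Fin n) (Fin n) ℝ :=
  1 - DwInvSqrt B lamW * (B * (Df B lamF)⁻¹ * Bᵀ) * DwInvSqrt B lamW

end Laplacians

/-! ### The degree-corrected stochastic block model -/

/-- Number of workers of type `k`. -/
def groupSize {n K : ℕ} (workerType : Fin n → Fin K) (k : Fin K) : ℕ :=
  (Finset.univ.filter fun i => workerType i = k).card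

/-- Parameters of the bipartite degree-corrected stochastic block model with `n` workers, `p` firms
and `K` worker types and firm types. The field `theta_sum` forces every firm type to be
represented, `workerType_surjective` says the same for worker types (so that `1 / n_k` makes
sense), and `prob_le_one` says that the Bernoulli parameters are probabilities. -/
structure BlockModel (n p K : ℕ) where
  workerType : Fin n → Fin K
  firmType : Fin p → Fin K
  theta : Fin p → ℝ
  affinity : Matrix (Fin K) (Fin K) ℝ
  workerType_surjective : Function.Surjective workerType
  theta_nonneg : ∀ j, 0 ≤ theta j
  theta_sum : ∀ l, ∑ j with firmType j = l, theta j = 1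
  affinity_nonneg : ∀ k l, 0 ≤ affinity k l
  prob_le_one : ∀ i j,
    1 / (groupSize workerType (workerType i) : ℝ) * theta j
      * affinity (workerType i) (firmType j) ≤ 1

namespace BlockModel

variable {n p K : ℕ} (m : BlockModel n p K)

/-- `n_k`. -/
def size (k : Fin K) : ℕ := groupSize m.workerType k

/-- The expected adjacency matrix, `p_{ij} = θ_j C(k_i, ℓ_j) / n_{k_i}`. -/
def expB : Matrix (Fin n) (Fin p) ℝ := Matrix.of fun i j =>
  1 / (m.size (m.workerType i) : ℝ) * m.theta j * m.affinity (m.workerType i) (m.firmType j)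

/-- The link probability `p_{ij}` as an element of `[0, 1]`. -/
def prob (i : Fin n) (j : Fin p) : unitInterval :=
  ⟨m.expB i j,
    mul_nonneg (mul_nonneg (by positivity) (m.theta_nonneg j)) (m.affinity_nonneg _ _),
    m.prob_le_one i j⟩

/-- `C(k, ·) / n_k`, the expected degree of a worker of type `k`. -/
def expWorkerDegree (k : Fin K) : ℝ := 1 / (m.size k : ℝ) * ∑ l, m.affinity k l

/-- `θ_j C(·, ℓ_j)`, the expected degree of firm `j`. -/
def expFirmDegree (j : Fin p) : ℝ := m.theta j * ∑ k, m.affinity k (m.firmType j)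

/-- Minimum expected worker degree. -/
def minW : ℝ := ⨅ k, m.expWorkerDegree k

/-- Maximum expected worker degree. -/
def maxW : ℝ := ⨆ k, m.expWorkerDegree k

/-- Minimum expected firm degree. -/
def minF : ℝ := ⨅ j, m.expFirmDegree j

/-- Maximum expected firm degree. -/
def maxF : ℝ := ⨆ j, m.expFirmDegree j

/-- The degrees of the expected network are the expected degrees of the model: workers. -/
theorem workerDegree_expB (i : Fin n) :
    workerDegree m.expB i = m.expWorkerDegree (m.workerType i) := by
  unfold workerDegree expWorkerDegree
  rw [← Finset.sum_fiberwise Finset.univ m.firmType, Finset.mul_sum]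
  refine Finset.sum_congr rfl fun l _ => ?_
  calc ∑ j with m.firmType j = l, m.expB i j
      = ∑ j with m.firmType j = l, m.theta j *
          (1 / (m.size (m.workerType i) : ℝ) * m.affinity (m.workerType i) l) := by
        refine Finset.sum_congr rfl fun j hj => ?_
        rw [Finset.mem_filter] at hj
        simp only [expB, Matrix.of_apply, hj.2]
        ring
    _ = _ := by rw [← Finset.sum_mul, m.theta_sum, one_mul]

/-- The degrees of the expected network are the expected degrees of the model: firms. -/
theorem firmDegree_expB (j : Fin p) : firmDegree m.expB j = m.expFirmDegree j := by
  unfold firmDegree expFirmDegree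
  rw [← Finset.sum_fiberwise Finset.univ m.workerType, Finset.mul_sum]
  refine Finset.sum_congr rfl fun k _ => ?_
  have hk : (m.size k : ℝ) ≠ 0 := by
    obtain ⟨i, hi⟩ := m.workerType_surjective k
    have : 0 < m.size k :=
      Finset.card_pos.2 ⟨i, Finset.mem_filter.2 ⟨Finset.mem_univ i, hi⟩⟩
    positivity
  calc ∑ i with m.workerType i = k, m.expB i j
      = ∑ i with m.workerType i = k,
          1 / (m.size k : ℝ) * m.theta j * m.affinity k (m.firmType j) := by
        refine Finset.sum_congr rfl fun i hi => ?_
        rw [Finset.mem_filter] at hi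
        simp only [expB, Matrix.of_apply, hi.2]
    _ = _ := by
        rw [Finset.sum_const, nsmul_eq_mul]
        change (m.size k : ℝ) * _ = _
        field_simp

/-- The random matrix `B = (d_{ij})` is a network drawn from the model: its entries are independent
and `d_{ij}` is Bernoulli with parameter `p_{ij}`. -/
structure IsNetwork {Ω : Type*} [MeasurableSpace Ω] (μ : Measure Ω)
    (B : Ω → Matrix (Fin n) (Fin p) ℝ) : Prop where
  hasLaw : ∀ i j, HasLaw (fun ω => B ω i j) (bernoulliMeasure (1 : ℝ) 0 (m.prob i j)) μ
  indep : iIndepFun (fun (e : Fin n × Fin p) (ω : Ω) => B ω e.1 e.2) μ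

end BlockModel

end RidgeNetwork

end

noncomputable section

namespace RidgeNetwork

/-! ### The Golden–Thompson inequality -/

section GoldenThompson

variable {V : Type*} [Fintype V] [DecidableEq V]

/-! The proof isolates a good event and then argues deterministically on it. On this event the
entries of `B` are nonnegative, every degree is within relative error `t` of its expected
regularized value, and the centred matrix normalized by the expected degrees has norm at most `t`.

Deterministic part: Cauchy–Schwarz makes the firm Laplacian coercive with constant `lamF`, so both
inverses have norm at most `lamF⁻¹`. Normalizing both Gram matrices by the same expected degrees
shows that the Laplacians differ by at most `21 * t * F`, where `F` bounds the expected regularized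
firm degrees (`norm_unnormLf_sub_le`). The identity `X⁻¹ - Y⁻¹ = -X⁻¹(X - Y)Y⁻¹` gives `21 * (F /
lamF ^ 2) * t`, and `21 ≤ 5 + 16r` whenever `r ≥ 1`.

Probabilistic part: one matrix Chernoff bound serves both the degrees (as `1 × 1` matrices) and the
normalized matrix (through its symmetric dilation). Each summand carries its variance compensator
inside the exponent, so that its exponential has mean at most the identity; Golden–Thompson then
removes the summands one at a time and the expected trace never exceeds the dimension
(`integral_trace_exp_le`). With `L = ln((n+p)/ε)` the failure probabilities are `2n·exp(-L)`,
`2p·exp(-L)` and `(n+p)·exp(-L)`, in total `3ε`, which is within both stated constants.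

The worker side is the firm side of the transposed graph. -/

theorem mul_pow_succ_eq {R : Type*} [Monoid R] (x y : R) (m : ℕ) :
    (x * y) ^ (m + 1) = x * (y * x) ^ m * y := by
  induction m with
  | zero => simp
  | succ m ih => rw [pow_succ, ih, pow_succ]; simp only [mul_assoc]

theorem trace_mul_pow_comm (X Y : Matrix V V ℝ) (m : ℕ) :
    ((X * Y) ^ m).trace = ((Y * X) ^ m).trace := by
  cases m with
  | zero => simp
  | succ m => rw [mul_pow_succ_eq, Matrix.trace_mul_comm, ← mul_assoc, pow_succ']

omit [DecidableEq V] in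
theorem trace_mul_le_half (X Y : Matrix V V ℝ) :
    (X * Y).trace ≤ ((X * Xᵀ).trace + (Y * Yᵀ).trace) / 2 := by
  have hY : (Y * Yᵀ).trace = ∑ i, ∑ j, Y j i * Y j i := by
    simp only [Matrix.trace, Matrix.diag, Matrix.mul_apply, Matrix.transpose_apply]
    exact Finset.sum_comm
  rw [hY]
  simp only [Matrix.trace, Matrix.diag, Matrix.mul_apply, Matrix.transpose_apply]
  rw [← Finset.sum_add_distrib, Finset.sum_div]
  refine Finset.sum_le_sum fun i _ => ?_
  rw [← Finset.sum_add_distrib, Finset.sum_div]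
  refine Finset.sum_le_sum fun j _ => ?_
  nlinarith [sq_nonneg (X i j - Y j i)]

/-- The two inequalities feed each other in a joint induction. The first at level `k` reduces `XY`
to `XY(XY)ᵀ`, whose power has the trace of the same power of `X²Y²`, where the second applies.
Conversely, the second applied to `WWᵀ` and `WᵀW`, whose powers have equal traces, advances the
first. -/
theorem trace_pow_le_aux (k : ℕ) :
    (∀ W : Matrix V V ℝ, (W ^ 2 ^ (k + 1)).trace ≤ ((W * Wᵀ) ^ 2 ^ k).trace) ∧
    ∀ X Y : Matrix V V ℝ, Xᵀ = X → Yᵀ = Y →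
      ((X * Y) ^ 2 ^ k).trace ≤ (X ^ 2 ^ k * Y ^ 2 ^ k).trace := by
  induction k with
  | zero =>
    refine ⟨fun W => ?_, fun X Y _ _ => by simp⟩
    simpa [pow_two] using trace_mul_le_half W W
  | succ k ih =>
    obtain ⟨ha, hb⟩ := ih
    refine ⟨fun W => ?_, fun X Y hX hY => ?_⟩
    · have e1 : (W ^ 2 ^ (k + 1 + 1)) = (W * W) ^ 2 ^ (k + 1) := by
        rw [← pow_two, ← pow_mul]; ring_nf
      have e2 : ((W * W * (W * W)ᵀ) ^ 2 ^ k).trace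
          = ((W * Wᵀ * (Wᵀ * W)) ^ 2 ^ k).trace := by
        rw [Matrix.transpose_mul, mul_assoc W W, trace_mul_pow_comm]
        simp only [mul_assoc]
      have h3 := hb (W * Wᵀ) (Wᵀ * W) (by simp) (by simp)
      have h4 := trace_mul_le_half ((W * Wᵀ) ^ 2 ^ k) ((Wᵀ * W) ^ 2 ^ k)
      have e5 : ((W * Wᵀ) ^ 2 ^ k)ᵀ = (W * Wᵀ) ^ 2 ^ k := by simp [Matrix.transpose_pow]
      have e6 : ((Wᵀ * W) ^ 2 ^ k)ᵀ = (Wᵀ * W) ^ 2 ^ k := by simp [Matrix.transpose_pow]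
      have e7 : 2 ^ k + 2 ^ k = 2 ^ (k + 1) := by ring
      rw [e5, e6, ← pow_add, ← pow_add, e7, trace_mul_pow_comm Wᵀ W] at h4
      rw [e1]
      refine (ha (W * W)).trans ?_
      rw [e2]
      linarith
    · have e2 : ((X * Y * (X * Y)ᵀ) ^ 2 ^ k).trace = ((X ^ 2 * Y ^ 2) ^ 2 ^ k).trace := by
        rw [Matrix.transpose_mul, hX, hY, mul_assoc X Y, trace_mul_pow_comm,
          trace_mul_pow_comm (X ^ 2)]
        simp only [pow_two, mul_assoc]
      have h3 := hb (X ^ 2) (Y ^ 2) (by simp [Matrix.transpose_pow, hX])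
        (by simp [Matrix.transpose_pow, hY])
      refine (ha (X * Y)).trans ?_
      rw [e2]
      refine h3.trans_eq ?_
      rw [← pow_mul, ← pow_mul, pow_succ' 2 k]

theorem norm_pow_sub_pow_le {A : Type*} [NormedRing A] [NormOneClass A] (x y : A) (c : ℝ)
    (hx : ‖x‖ ≤ c) (hy : ‖y‖ ≤ c) (m : ℕ) :
    ‖x ^ (m + 1) - y ^ (m + 1)‖ ≤ (m + 1) * c ^ m * ‖x - y‖ := by
  have hc : 0 ≤ c := (norm_nonneg x).trans hx
  induction m with
  | zero => simp
  | succ m ih =>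
    have e : x ^ (m + 1 + 1) - y ^ (m + 1 + 1)
        = x * (x ^ (m + 1) - y ^ (m + 1)) + (x - y) * y ^ (m + 1) := by
      rw [pow_succ' x, pow_succ' y]; noncomm_ring
    rw [e]
    have h1 : ‖x * (x ^ (m + 1) - y ^ (m + 1))‖ ≤ c * ((m + 1) * c ^ m * ‖x - y‖) :=
      (norm_mul_le _ _).trans (mul_le_mul hx ih (norm_nonneg _) hc)
    have h2 : ‖(x - y) * y ^ (m + 1)‖ ≤ ‖x - y‖ * c ^ (m + 1) :=
      (norm_mul_le _ _).trans (mul_le_mul_of_nonneg_left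
        ((norm_pow_le _ _).trans (pow_le_pow_left₀ (norm_nonneg _) hy _)) (norm_nonneg _))
    refine (norm_add_le _ _).trans ((add_le_add h1 h2).trans_eq ?_)
    push_cast
    ring

theorem norm_exp_le_exp_norm {A : Type*} [NormedRing A] [NormOneClass A] [NormedAlgebra ℝ A]
    [CompleteSpace A] (a : A) : ‖NormedSpace.exp a‖ ≤ Real.exp ‖a‖ := by
  rw [NormedSpace.exp_eq_tsum ℝ, Real.exp_eq_exp_ℝ, NormedSpace.exp_eq_tsum ℝ]
  have hs : Summable fun n : ℕ => ((n.factorial : ℝ)⁻¹ • ‖a‖ ^ n) :=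
    NormedSpace.expSeries_summable' ‖a‖
  refine tsum_of_norm_bounded hs.hasSum fun n => ?_
  rw [norm_smul, Real.norm_of_nonneg (by positivity), smul_eq_mul]
  exact mul_le_mul_of_nonneg_left (norm_pow_le _ _) (by positivity)

/-- The Lie–Trotter product formula along powers of two. -/
theorem tendsto_exp_mul_exp_pow {A : Type*} [NormedRing A] [NormOneClass A] [NormedAlgebra ℝ A]
    [CompleteSpace A] (a b : A) :
    Filter.Tendsto (fun k : ℕ => (NormedSpace.exp (((2 : ℝ) ^ k)⁻¹ • a) *
      NormedSpace.exp (((2 : ℝ) ^ k)⁻¹ • b)) ^ 2 ^ k) Filter.atTop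
      (nhds (NormedSpace.exp (a + b))) := by
  let : NormedAlgebra ℚ A := NormedAlgebra.restrictScalars ℚ ℝ A
  -- `g` has zero derivative at `0`, so `2^k * ‖g (2^(-k))‖` tends to `0`; telescoping the powers
  -- costs only the fixed factor `exp (‖a‖ + ‖b‖)`.
  set g : ℝ → A := fun s => NormedSpace.exp (s • a) * NormedSpace.exp (s • b)
    - NormedSpace.exp (s • (a + b)) with hg
  have hd : HasDerivAt g 0 0 := by
    have := ((hasDerivAt_exp_smul_const (𝕂 := ℝ) a 0).mul
      (hasDerivAt_exp_smul_const (𝕂 := ℝ) b 0)).sub (hasDerivAt_exp_smul_const (𝕂 := ℝ) (a + b) 0)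
    simp only [zero_smul, NormedSpace.exp_zero, one_mul, mul_one, sub_self] at this
    exact this
  have h2 : Filter.Tendsto (fun k : ℕ => ((2 : ℝ) ^ k)⁻¹) Filter.atTop
      (nhdsWithin 0 (Set.Ioi 0)) := by
    refine tendsto_nhdsWithin_iff.2 ⟨?_, Filter.Eventually.of_forall fun k => by
      simp⟩
    exact (tendsto_pow_atTop_atTop_of_one_lt (by norm_num : (1 : ℝ) < 2)).inv_tendsto_atTop
  have h3 := (hd.tendsto_slope_zero_right.comp h2).norm
  have hg0 : g 0 = 0 := by simp [hg]
  set c := ‖a‖ + ‖b‖ with hc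
  have h4 := h3.const_mul (Real.exp c)
  rw [norm_zero, mul_zero] at h4
  rw [tendsto_iff_norm_sub_tendsto_zero]
  refine squeeze_zero (fun _ => norm_nonneg _) (fun k => ?_) h4
  have hk : (0 : ℝ) < ((2 : ℝ) ^ k)⁻¹ := by positivity
  set s := ((2 : ℝ) ^ k)⁻¹ with hs
  have hb1 : ∀ x : A, ‖NormedSpace.exp (s • x)‖ ≤ Real.exp (s * ‖x‖) := fun x =>
    (norm_exp_le_exp_norm _).trans_eq (by rw [norm_smul, Real.norm_of_nonneg hk.le])
  have hX : ‖NormedSpace.exp (s • a) * NormedSpace.exp (s • b)‖ ≤ Real.exp (s * c) := by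
    refine (norm_mul_le _ _).trans ((mul_le_mul (hb1 a) (hb1 b) (norm_nonneg _)
      (Real.exp_pos _).le).trans_eq ?_)
    rw [← Real.exp_add, hc, mul_add]
  have hY : ‖NormedSpace.exp (s • (a + b))‖ ≤ Real.exp (s * c) :=
    (hb1 _).trans (Real.exp_le_exp.2 (mul_le_mul_of_nonneg_left (norm_add_le _ _) hk.le))
  have hpow : NormedSpace.exp (s • (a + b)) ^ 2 ^ k = NormedSpace.exp (a + b) := by
    rw [← NormedSpace.exp_nsmul, ← Nat.cast_smul_eq_nsmul ℝ, smul_smul]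
    simp [hs]
  obtain ⟨m, hm⟩ : ∃ m, 2 ^ k = m + 1 := Nat.exists_eq_succ_of_ne_zero (by positivity)
  have hmR : (2 : ℝ) ^ k = m + 1 := by exact_mod_cast hm
  have hmain := norm_pow_sub_pow_le _ _ _ hX hY m
  rw [← hm, hpow] at hmain
  refine hmain.trans ?_
  have e1 : ‖((fun t : ℝ => t⁻¹ • (g (0 + t) - g 0)) ∘ fun k : ℕ => ((2 : ℝ) ^ k)⁻¹) k‖
      = (m + 1) * ‖NormedSpace.exp (s • a) * NormedSpace.exp (s • b)
        - NormedSpace.exp (s • (a + b))‖ := by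
    simp only [Function.comp, hg0, sub_zero, zero_add, norm_smul, inv_inv, hmR]
    rw [Real.norm_of_nonneg (by positivity), hs, hmR]
  rw [e1, ← mul_assoc]
  refine mul_le_mul_of_nonneg_right ?_ (norm_nonneg _)
  rw [mul_comm]
  refine mul_le_mul_of_nonneg_right ?_ (by positivity)
  rw [← Real.exp_nat_mul]
  refine Real.exp_le_exp.2 ?_
  have : (m : ℝ) * s ≤ 1 := by
    rw [hs, hmR, ← div_eq_mul_inv, div_le_one (by positivity)]; linarith
  calc (m : ℝ) * (s * c) = m * s * c := by ring
    _ ≤ 1 * c := mul_le_mul_of_nonneg_right this (by positivity)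
    _ = c := one_mul c

theorem golden_thompson (A B : Matrix V V ℝ) (hA : Aᵀ = A) (hB : Bᵀ = B) :
    (NormedSpace.exp (A + B)).trace ≤ (NormedSpace.exp A * NormedSpace.exp B).trace := by
  rcases isEmpty_or_nonempty V with hV | hV
  · simp [Matrix.trace]
  have h := tendsto_exp_mul_exp_pow A B
  have hc : Continuous fun M : Matrix V V ℝ => M.trace := continuous_id.matrix_trace
  refine le_of_tendsto ((hc.tendsto _).comp h) (Filter.Eventually.of_forall fun k => ?_)
  have h1 := (trace_pow_le_aux (V := V) k).2 (NormedSpace.exp (((2 : ℝ) ^ k)⁻¹ • A))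
    (NormedSpace.exp (((2 : ℝ) ^ k)⁻¹ • B))
    (by rw [← Matrix.exp_transpose, Matrix.transpose_smul, hA])
    (by rw [← Matrix.exp_transpose, Matrix.transpose_smul, hB])
  have key : ∀ C : Matrix V V ℝ,
      NormedSpace.exp (((2 : ℝ) ^ k)⁻¹ • C) ^ 2 ^ k = NormedSpace.exp C := by
    intro C
    rw [← Matrix.exp_nsmul, ← Nat.cast_smul_eq_nsmul ℝ, smul_smul]
    simp
  rw [key, key] at h1
  exact h1

end GoldenThompson

/-! ### Exponentials of matrices -/

section MatrixExp

variable {V : Type*} [Fintype V] [DecidableEq V]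

theorem exp_smul_idempotent (P : Matrix V V ℝ) (hP : P * P = P) (a : ℝ) :
    NormedSpace.exp (a • P) = 1 + (Real.exp a - 1) • P := by
  rw [NormedSpace.exp_eq_tsum ℝ]
  have h1 : HasSum (fun n : ℕ => ((n.factorial : ℝ)⁻¹ * a ^ n) • P) (Real.exp a • P) := by
    refine HasSum.smul_const ?_ P
    rw [Real.exp_eq_exp_ℝ]
    simpa using NormedSpace.exp_series_hasSum_exp' (𝕂 := ℝ) a
  -- Corrects the constant term of the series, where `P ^ 0` is `1` and not `P`.
  have h2 : HasSum (fun n : ℕ => if n = 0 then (1 - P : Matrix V V ℝ) else 0) (1 - P) :=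
    hasSum_ite_eq 0 _
  have h3 := h1.add h2
  refine Eq.trans (HasSum.tsum_eq (h3.congr_fun ?_)) ?_
  · intro n
    rcases n with _ | n
    · simp
    · have : P ^ (n + 1) = P := by
        induction n with
        | zero => simp
        | succ n ih => rw [pow_succ, ih, hP]
      rw [smul_pow, this, smul_smul]
      simp
  · rw [sub_smul, one_smul]; abel

theorem exp_smul_add_smul_idempotent (P R : Matrix V V ℝ) (hP : P * P = P) (hR : R * R = R)
    (hPR : P * R = 0) (hRP : R * P = 0) (a b : ℝ) :
    NormedSpace.exp (a • P + b • R) = 1 + (Real.exp a - 1) • P + (Real.exp b - 1) • R := by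
  rw [Matrix.exp_add_of_commute, exp_smul_idempotent P hP, exp_smul_idempotent R hR]
  · simp [add_mul, mul_add, hPR]
  · simp [Commute, SemiconjBy, hPR, hRP]

/-- With `R = exp(H/2)` the trace is the squared Frobenius norm of `R * P`. -/
theorem trace_exp_mul_idempotent_nonneg (H P : Matrix V V ℝ) (hH : Hᵀ = H) (hPt : Pᵀ = P)
    (hP : P * P = P) : 0 ≤ (NormedSpace.exp H * P).trace := by
  set R := NormedSpace.exp ((2 : ℝ)⁻¹ • H) with hR
  have h1 : NormedSpace.exp H = Rᵀ * R := by
    rw [hR, ← Matrix.exp_transpose, Matrix.transpose_smul, hH,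
      ← Matrix.exp_add_of_commute _ _ (Commute.refl _), ← add_smul]
    norm_num
  have h2 : (NormedSpace.exp H * P).trace = ((R * P)ᵀ * (R * P)).trace := by
    rw [h1, Matrix.transpose_mul, hPt, mul_assoc P, Matrix.trace_mul_comm P]
    simp only [mul_assoc, hP]
  rw [h2]
  generalize R * P = Q
  simp only [Matrix.trace, Matrix.diag, Matrix.mul_apply, Matrix.transpose_apply]
  exact Finset.sum_nonneg fun i _ => Finset.sum_nonneg fun j _ => mul_self_nonneg _

/-- In an eigenbasis the quadratic form at a unit vector is a weighted average of eigenvalues, so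
some eigenvalue is at least as large, and its exponential is one of the positive terms of the trace.
-/
theorem exp_dotProduct_le_trace_exp (G : Matrix V V ℝ) (hG : Gᵀ = G) (u : V → ℝ)
    (hu : u ⬝ᵥ u = 1) : Real.exp (u ⬝ᵥ G *ᵥ u) ≤ (NormedSpace.exp G).trace := by
  have hH : G.IsHermitian := by rwa [Matrix.IsHermitian, Matrix.conjTranspose_eq_transpose_of_trivial]
  set U : Matrix V V ℝ := hH.eigenvectorUnitary.1 with hU
  set l := hH.eigenvalues
  have hUU : Uᵀ * U = 1 := by
    have := (Matrix.mem_unitaryGroup_iff' (A := U)).1 hH.eigenvectorUnitary.2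
    rwa [Matrix.star_eq_conjTranspose, Matrix.conjTranspose_eq_transpose_of_trivial] at this
  have hUU' : U * Uᵀ = 1 := by
    have := (Matrix.mem_unitaryGroup_iff (A := U)).1 hH.eigenvectorUnitary.2
    rwa [Matrix.star_eq_conjTranspose, Matrix.conjTranspose_eq_transpose_of_trivial] at this
  have hspec : G = U * Matrix.diagonal l * Uᵀ := by
    have := hH.spectral_theorem
    rw [Unitary.conjStarAlgAut_apply] at this
    simpa [Matrix.star_eq_conjTranspose, Matrix.conjTranspose_eq_transpose_of_trivial] using this
  have hinv : U⁻¹ = Uᵀ := Matrix.inv_eq_left_inv hUU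
  have hexp : (NormedSpace.exp G).trace = ∑ k, Real.exp (l k) := by
    have hunit : IsUnit U := IsUnit.of_mul_eq_one _ hUU'
    rw [hspec, ← hinv, Matrix.exp_conj _ _ hunit, hinv, Matrix.trace_mul_comm, ← mul_assoc, hUU,
      one_mul, Matrix.exp_diagonal, Matrix.trace_diagonal]
    refine Finset.sum_congr rfl fun k _ => ?_
    rw [Pi.coe_exp, Real.exp_eq_exp_ℝ]
  set y := Uᵀ *ᵥ u with hy
  have hyy : ∑ k, y k ^ 2 = 1 := by
    have : y ⬝ᵥ y = 1 := by
      rw [hy, Matrix.dotProduct_mulVec, Matrix.vecMul_transpose, Matrix.mulVec_mulVec, hUU',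
        Matrix.one_mulVec, hu]
    rw [← this]; simp [dotProduct, pow_two]
  have hq : u ⬝ᵥ G *ᵥ u = ∑ k, l k * y k ^ 2 := by
    rw [hspec, ← Matrix.mulVec_mulVec, ← Matrix.mulVec_mulVec, Matrix.dotProduct_mulVec,
      ← Matrix.mulVec_transpose, ← hy]
    simp only [dotProduct, Matrix.mulVec_diagonal]
    exact Finset.sum_congr rfl fun k _ => by ring
  obtain ⟨k, hk⟩ : ∃ k, u ⬝ᵥ G *ᵥ u ≤ l k := by
    by_contra! hcon
    have h1 : ∑ k, l k * y k ^ 2 < ∑ k, (u ⬝ᵥ G *ᵥ u) * y k ^ 2 := by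
      obtain ⟨k0, hk0⟩ : ∃ k, y k ≠ 0 := by
        by_contra! h0
        simp [h0] at hyy
      refine Finset.sum_lt_sum
        (fun k _ => mul_le_mul_of_nonneg_right (hcon k).le (sq_nonneg _))
        ⟨k0, Finset.mem_univ _, mul_lt_mul_of_pos_right (hcon k0) (by positivity)⟩
    rw [← Finset.mul_sum, hyy, mul_one, ← hq] at h1
    exact lt_irrefl _ h1
  rw [hexp]
  exact (Real.exp_le_exp.2 hk).trans
    (Finset.single_le_sum (f := fun k => Real.exp (l k)) (fun k _ => (Real.exp_pos _).le)
      (Finset.mem_univ k))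

end MatrixExp

/-- Combines `1 + x ≤ exp x` with `exp s - 1 - s ≤ 3/4 * s ^ 2`, the second-order Taylor remainder
bound on `|s| ≤ 1`; this is the source of the `3/4` in `increment`. -/
theorem bernoulli_mgf_le (q s : ℝ) (hq0 : 0 ≤ q) (hs : |s| ≤ 1) :
    q * Real.exp (s * (1 - q)) + (1 - q) * Real.exp (s * (0 - q)) ≤ Real.exp (3 / 4 * q * s ^ 2) := by
  have h1 : q * Real.exp (s * (1 - q)) + (1 - q) * Real.exp (s * (0 - q))
      = Real.exp (-(s * q)) * (q * (Real.exp s - 1) + 1) := by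
    rw [show s * (1 - q) = s + -(s * q) by ring, show s * (0 - q) = -(s * q) by ring, Real.exp_add]
    ring
  have h2 := Real.add_one_le_exp (q * (Real.exp s - 1))
  have h3 : Real.exp s - 1 - s ≤ 3 / 4 * s ^ 2 := by
    have := Real.exp_bound hs (n := 2) (by norm_num)
    norm_num [Finset.sum_range_succ, Nat.factorial] at this
    have := (abs_le.1 this).2
    linarith
  rw [h1]
  refine (mul_le_mul_of_nonneg_left h2 (Real.exp_pos _).le).trans ?_
  rw [← Real.exp_add]
  refine Real.exp_le_exp.2 ?_
  nlinarith [mul_le_mul_of_nonneg_left h3 hq0]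

/-! ### A matrix Chernoff bound for sums of independent centered Bernoulli multiples -/

section MatrixChernoff

variable {V E Ω : Type*} [Fintype V] [DecidableEq V] [Fintype E] [DecidableEq E]
  [MeasurableSpace Ω]

/-- The compensated increment `c (x - q) S - (3/4) q c² S²`. -/
def increment (S : Matrix V V ℝ) (c q x : ℝ) : Matrix V V ℝ :=
  (c * (x - q)) • S - (3 / 4 * q * c ^ 2) • (S * S)

omit [DecidableEq V] in
theorem increment_transpose (S : Matrix V V ℝ) (hS : Sᵀ = S) (c q x : ℝ) :
    (increment S c q x)ᵀ = increment S c q x := by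
  simp [increment, Matrix.transpose_mul, hS]

/-- Since `S³ = S`, the matrices `(S² ± S)/2` are complementary idempotents on the eigenspaces `±1`,
and the increment is a scalar on each of them and zero on the kernel. -/
theorem exp_increment (S : Matrix V V ℝ) (hS3 : S * S * S = S) (c q x : ℝ) :
    NormedSpace.exp (increment S c q x) =
      1 + (Real.exp (c * (x - q) - 3 / 4 * q * c ^ 2) - 1) • ((2 : ℝ)⁻¹ • (S * S + S))
        + (Real.exp (-c * (x - q) - 3 / 4 * q * c ^ 2) - 1) • ((2 : ℝ)⁻¹ • (S * S - S)) := by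
  have h4 : S * S * (S * S) = S * S := by rw [← mul_assoc, hS3]
  have h3 : S * (S * S) = S := by rw [← mul_assoc, hS3]
  rw [← exp_smul_add_smul_idempotent]
  · congr 1
    simp only [increment, smul_add, smul_sub, smul_smul]
    module
  · simp only [smul_mul_smul_comm, add_mul, mul_add, h4, hS3, h3]
    module
  · simp only [smul_mul_smul_comm, sub_mul, mul_sub, h4, hS3, h3]
    module
  · simp only [smul_mul_smul_comm, add_mul, mul_sub, h4, hS3, h3]
    module
  · simp only [smul_mul_smul_comm, sub_mul, mul_add, h4, hS3, h3]
    module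

/-- On each of the two eigenspaces the compensator cancels the scalar Bernoulli bound, so the mean
exponential is at most the identity; pairing with `exp H` preserves this because its trace against
each projection is nonnegative. -/
theorem trace_exp_mul_mean_le (H S : Matrix V V ℝ) (hH : Hᵀ = H) (hS : Sᵀ = S)
    (hS3 : S * S * S = S) (c q : ℝ) (hc : |c| ≤ 1) (hq : 0 ≤ q) :
    (NormedSpace.exp H * (q • NormedSpace.exp (increment S c q 1)
      + (1 - q) • NormedSpace.exp (increment S c q 0))).trace ≤ (NormedSpace.exp H).trace := by
  have h4 : S * S * (S * S) = S * S := by rw [← mul_assoc, hS3]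
  have h3 : S * (S * S) = S := by rw [← mul_assoc, hS3]
  have hscal : ∀ s : ℝ, |s| ≤ 1 → s ^ 2 = c ^ 2 →
      q * Real.exp (s * (1 - q) - 3 / 4 * q * c ^ 2)
        + (1 - q) * Real.exp (s * (0 - q) - 3 / 4 * q * c ^ 2) ≤ 1 := by
    intro s hs hsc
    have := mul_le_mul_of_nonneg_right (bernoulli_mgf_le q s hq hs)
      (Real.exp_pos (-(3 / 4 * q * c ^ 2))).le
    rw [← Real.exp_add, hsc, add_neg_cancel, Real.exp_zero] at this
    rw [sub_eq_add_neg _ (3 / 4 * q * c ^ 2), sub_eq_add_neg _ (3 / 4 * q * c ^ 2), Real.exp_add,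
      Real.exp_add]
    linarith
  have hp := trace_exp_mul_idempotent_nonneg H ((2 : ℝ)⁻¹ • (S * S + S)) hH
    (by simp [Matrix.transpose_mul, hS])
    (by simp only [smul_mul_smul_comm, add_mul, mul_add, h4, hS3, h3]; module)
  have hm := trace_exp_mul_idempotent_nonneg H ((2 : ℝ)⁻¹ • (S * S - S)) hH
    (by simp [Matrix.transpose_mul, hS])
    (by simp only [smul_mul_smul_comm, sub_mul, mul_sub, h4, hS3, h3]; module)
  have h1 := hscal c hc rfl
  have h2 := hscal (-c) (by rwa [abs_neg]) (by ring)
  rw [exp_increment S hS3, exp_increment S hS3]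
  generalize (2 : ℝ)⁻¹ • (S * S + S) = P at *
  generalize (2 : ℝ)⁻¹ • (S * S - S) = R at *
  simp only [Matrix.mul_add, Matrix.mul_smul, smul_add, Matrix.trace_add, Matrix.trace_smul,
    smul_eq_mul, mul_one]
  nlinarith [mul_nonneg hp (sub_nonneg.2 h1), mul_nonneg hm (sub_nonneg.2 h2)]

omit [Fintype E] [DecidableEq E] in
theorem continuous_exp_increment (S : E → Matrix V V ℝ) (c q : E → ℝ) (s : Finset E) :
    Continuous fun x : s → ℝ =>
      NormedSpace.exp (∑ e : s, increment (S e) (c e) (q e) (x e)) := by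
  have : NormedAlgebra ℚ (Matrix V V ℝ) := NormedAlgebra.restrictScalars ℚ ℝ _
  refine NormedSpace.exp_continuous.comp (continuous_finsetSum _ fun e _ => ?_)
  unfold increment
  fun_prop

omit [DecidableEq E] in
-- The variables almost surely lie in a compact cube, on which a continuous function is bounded.
theorem integrable_comp_of_continuous {μ : Measure Ω} [IsFiniteMeasure μ] (X : E → Ω → ℝ)
    (hX : ∀ e, AEMeasurable (X e) μ) (h01 : ∀ e, ∀ᵐ ω ∂μ, X e ω ∈ Set.Icc (0 : ℝ) 1)
    (f : (E → ℝ) → ℝ) (hf : Continuous f) : Integrable (fun ω => f fun e => X e ω) μ := by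
  obtain ⟨C, hC⟩ := (isCompact_Icc (a := (0 : E → ℝ)) (b := 1)).exists_bound_of_continuousOn
    hf.continuousOn
  refine Integrable.of_bound
    (hf.measurable.comp_aemeasurable (aemeasurable_pi_lambda _ hX)).aestronglyMeasurable C ?_
  filter_upwards [ae_all_iff.2 h01] with ω hω
  exact hC _ ⟨fun e => (hω e).1, fun e => (hω e).2⟩

omit [Fintype E] [DecidableEq E] in
theorem ae_mem_Icc_of_hasLaw {μ : Measure Ω} {X : Ω → ℝ} {q : unitInterval}
    (h : HasLaw X (bernoulliMeasure (1 : ℝ) 0 q) μ) : ∀ᵐ ω ∂μ, X ω = 0 ∨ X ω = 1 := by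
  refine (h.ae_iff (p := fun x => x = 0 ∨ x = 1) ?_).2 ?_
  · exact measurableSet_setOfPred.1 ((measurableSet_singleton (0 : ℝ)).union (measurableSet_singleton 1))
  · rw [ae_iff]
    refine bernoulliMeasure_apply_of_notMem_of_notMem q ?_ (by simp) (by simp)
    exact ((measurableSet_singleton (0 : ℝ)).union (measurableSet_singleton 1)).compl

theorem integral_trace_exp_le {μ : Measure Ω} [IsProbabilityMeasure μ] (X : E → Ω → ℝ)
    (q : E → unitInterval) (hX : ∀ e, HasLaw (X e) (bernoulliMeasure (1 : ℝ) 0 (q e)) μ)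
    (hind : iIndepFun X μ) (S : E → Matrix V V ℝ) (hS : ∀ e, (S e)ᵀ = S e)
    (hS3 : ∀ e, S e * S e * S e = S e) (c : E → ℝ) (hc : ∀ e, |c e| ≤ 1) (s : Finset E) :
    ∫ ω, (NormedSpace.exp (∑ e ∈ s, increment (S e) (c e) (q e) (X e ω))).trace ∂μ
      ≤ Fintype.card V := by
  have hm : ∀ e, AEMeasurable (X e) μ := fun e => (hX e).aemeasurable
  have h01 : ∀ e, ∀ᵐ ω ∂μ, X e ω ∈ Set.Icc (0 : ℝ) 1 := fun e => by
    filter_upwards [ae_mem_Icc_of_hasLaw (hX e)] with ω hω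
    rcases hω with h | h <;> simp [h]
  induction s using Finset.induction_on with
  | empty => simp
  | insert e s hes ih =>
    have hcont : ∀ s : Finset E, Continuous fun x : E → ℝ =>
        NormedSpace.exp (∑ e ∈ s, increment (S e) (c e) (q e) (x e)) := by
      intro s
      have := (continuous_exp_increment S c (fun e => (q e : ℝ)) s).comp
        (continuous_pi fun e => continuous_apply e.1 : Continuous fun (x : E → ℝ) (e : s) => x e)
      refine this.congr fun x => ?_
      simp only [Function.comp]
      rw [Finset.sum_coe_sort s fun e => increment (S e) (c e) (q e) (x e)]
    set H : (E → ℝ) → Matrix V V ℝ := fun x => ∑ e ∈ s, increment (S e) (c e) (q e) (x e) with hH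
    have hHt : ∀ x, (H x)ᵀ = H x := fun x => by
      simp only [hH, Matrix.transpose_sum, increment_transpose _ (hS _)]
    set Y : ℝ → Matrix V V ℝ := fun x => increment (S e) (c e) (q e) x with hY
    have hYc : Continuous fun x => NormedSpace.exp (Y x) := by
      have : NormedAlgebra ℚ (Matrix V V ℝ) := NormedAlgebra.restrictScalars ℚ ℝ _
      refine NormedSpace.exp_continuous.comp ?_
      simp only [hY, increment]
      fun_prop
    set Q : Matrix V V ℝ := (q e : ℝ) • NormedSpace.exp (Y 1)
      + (1 - q e : ℝ) • NormedSpace.exp (Y 0) with hQ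
    have hQi : ∀ a b, ∫ ω, NormedSpace.exp (Y (X e ω)) a b ∂μ = Q a b := by
      intro a b
      have h1 := (hX e).integral_comp (f := fun x => NormedSpace.exp (Y x) a b)
        (hYc.matrix_elem a b).aestronglyMeasurable
      have h2 := integral_bernoulliMeasure (1 : ℝ) 0 (q e) fun x => NormedSpace.exp (Y x) a b
      rw [h2] at h1
      simpa [hQ, Function.comp] using h1
    have hprod : ∀ a b, ∫ ω, NormedSpace.exp (H fun e => X e ω) a b
          * NormedSpace.exp (Y (X e ω)) b a ∂μ
        = (∫ ω, NormedSpace.exp (H fun e => X e ω) a b ∂μ) * Q b a := by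
      intro a b
      -- The new variable is independent of the whole block `s`, so entrywise the expectation
      -- factors and `exp Y` may be replaced by its mean `Q`.
      have hI := hind.indepFun_finset₀ s {e} (by simpa using hes) hm
      have h1 := hI.integral_fun_comp_mul_comp (𝕜 := ℝ)
        (f := fun x : s → ℝ => NormedSpace.exp (∑ e : s, increment (S e) (c e) (q e) (x e)) a b)
        (g := fun x : ({e} : Finset E) → ℝ =>
          NormedSpace.exp (Y (x ⟨e, Finset.mem_singleton_self e⟩)) b a)
        (aemeasurable_pi_lambda _ fun i => hm i) (aemeasurable_pi_lambda _ fun i => hm i)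
        ((continuous_exp_increment S c (fun e => (q e : ℝ)) s).matrix_elem a b).aestronglyMeasurable
        ((hYc.comp (continuous_apply _)).matrix_elem b a).aestronglyMeasurable
      rw [hQi] at h1
      have h2 : ∀ ω, ∑ e : s, increment (S e) (c e) (q e) (X e ω) = H fun e => X e ω :=
        fun ω => Finset.sum_coe_sort s fun e => increment (S e) (c e) (q e) (X e ω)
      simpa only [h2] using h1
    have hint : ∀ f : (E → ℝ) → ℝ, Continuous f → Integrable (fun ω => f fun e => X e ω) μ :=
      integrable_comp_of_continuous X hm h01
    have hHc : Continuous fun x => NormedSpace.exp (H x) := hcont s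
    have hYe : Continuous fun x : E → ℝ => NormedSpace.exp (Y (x e)) :=
      hYc.comp (continuous_apply e)
    calc ∫ ω, (NormedSpace.exp (∑ e ∈ insert e s, increment (S e) (c e) (q e) (X e ω))).trace ∂μ
        ≤ ∫ ω, (NormedSpace.exp (H fun e => X e ω) * NormedSpace.exp (Y (X e ω))).trace ∂μ := by
          refine integral_mono (hint _ (hcont _).matrix_trace)
            (hint _ (hHc.matrix_mul hYe).matrix_trace) fun ω => ?_
          simp only [Finset.sum_insert hes]
          rw [add_comm]
          exact golden_thompson _ _ (hHt _) (increment_transpose _ (hS e) _ _ _)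
      _ = ∫ ω, (NormedSpace.exp (H fun e => X e ω) * Q).trace ∂μ := by
          simp only [Matrix.trace, Matrix.diag, Matrix.mul_apply]
          rw [integral_finsetSum, integral_finsetSum]
          · refine Finset.sum_congr rfl fun a _ => ?_
            rw [integral_finsetSum, integral_finsetSum]
            · refine Finset.sum_congr rfl fun b _ => ?_
              rw [hprod, integral_mul_const]
            · exact fun b _ => (hint (fun x => NormedSpace.exp (H x) a b)
                (hHc.matrix_elem a b)).mul_const _
            · exact fun b _ => hint
                (fun x => NormedSpace.exp (H x) a b * NormedSpace.exp (Y (x e)) b a)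
                ((hHc.matrix_elem a b).mul (hYe.matrix_elem b a))
          · exact fun a _ => integrable_finsetSum _ fun b _ =>
              (hint (fun x => NormedSpace.exp (H x) a b) (hHc.matrix_elem a b)).mul_const _
          · exact fun a _ => integrable_finsetSum _ fun b _ => hint
                (fun x => NormedSpace.exp (H x) a b * NormedSpace.exp (Y (x e)) b a)
                ((hHc.matrix_elem a b).mul (hYe.matrix_elem b a))
      _ ≤ ∫ ω, (NormedSpace.exp (H fun e => X e ω)).trace ∂μ := by
          refine integral_mono (hint _ (hHc.matrix_mul continuous_const).matrix_trace)
            (hint _ hHc.matrix_trace) fun ω => ?_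
          exact trace_exp_mul_mean_le _ _ (hHt _) (hS e) (hS3 e) _ _ (hc e) (q e).2.1
      _ ≤ Fintype.card V := ih

end MatrixChernoff

/-! ### Tail bounds from the trace moment bound -/

section Tails

variable {V E Ω : Type*} [Fintype V] [DecidableEq V] [Fintype E] [DecidableEq E]
  [MeasurableSpace Ω]

/-- Markov's inequality for the trace of the exponential. Quantifying over unit vectors expresses
that the largest eigenvalue reaches `κ`. -/
theorem measureReal_exists_increment_le {μ : Measure Ω} [IsProbabilityMeasure μ] (X : E → Ω → ℝ)
    (q : E → unitInterval) (hX : ∀ e, HasLaw (X e) (bernoulliMeasure (1 : ℝ) 0 (q e)) μ)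
    (hind : iIndepFun X μ) (S : E → Matrix V V ℝ) (hS : ∀ e, (S e)ᵀ = S e)
    (hS3 : ∀ e, S e * S e * S e = S e) (c : E → ℝ) (hc : ∀ e, |c e| ≤ 1) (s : Finset E) (κ : ℝ) :
    μ.real {ω | ∃ u : V → ℝ, u ⬝ᵥ u = 1 ∧
      κ ≤ u ⬝ᵥ (∑ e ∈ s, increment (S e) (c e) (q e) (X e ω)) *ᵥ u}
      ≤ Fintype.card V * Real.exp (-κ) := by
  set H : (E → ℝ) → Matrix V V ℝ := fun x => ∑ e ∈ s, increment (S e) (c e) (q e) (x e) with hH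
  have hHt : ∀ x, (H x)ᵀ = H x := fun x => by
    simp only [hH, Matrix.transpose_sum, increment_transpose _ (hS _)]
  have hcont : Continuous fun x => NormedSpace.exp (H x) := by
    have : NormedAlgebra ℚ (Matrix V V ℝ) := NormedAlgebra.restrictScalars ℚ ℝ _
    refine NormedSpace.exp_continuous.comp (continuous_finsetSum _ fun e _ => ?_)
    unfold increment
    fun_prop
  have hint := integrable_comp_of_continuous X (fun e => (hX e).aemeasurable) (fun e => by
    filter_upwards [ae_mem_Icc_of_hasLaw (hX e)] with ω hω
    rcases hω with h | h <;> simp [h]) _ hcont.matrix_trace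
  have hnn : ∀ x, 0 ≤ (NormedSpace.exp (H x)).trace := fun x => by
    simpa using trace_exp_mul_idempotent_nonneg (H x) 1 (hHt x) (by simp) (by simp)
  have hmark := mul_meas_ge_le_integral_of_nonneg
    (Filter.Eventually.of_forall fun ω => hnn fun e => X e ω) hint (Real.exp κ)
  have hE := integral_trace_exp_le X q hX hind S hS hS3 c hc s
  have hsub : μ.real {ω | ∃ u : V → ℝ, u ⬝ᵥ u = 1 ∧ κ ≤ u ⬝ᵥ (H fun e => X e ω) *ᵥ u}
      ≤ μ.real {ω | Real.exp κ ≤ (NormedSpace.exp (H fun e => X e ω)).trace} := by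
    refine measureReal_mono ?_
    rintro ω ⟨u, hu, hκ⟩
    exact (Real.exp_le_exp.2 hκ).trans (exp_dotProduct_le_trace_exp _ (hHt _) u hu)
  refine hsub.trans ?_
  rw [Real.exp_neg, ← div_eq_mul_inv, le_div_iff₀ (Real.exp_pos _), mul_comm]
  exact hmark.trans hE

theorem measureReal_abs_sum_ge_le {μ : Measure Ω} [IsProbabilityMeasure μ] (X : E → Ω → ℝ)
    (q : E → unitInterval) (hX : ∀ e, HasLaw (X e) (bernoulliMeasure (1 : ℝ) 0 (q e)) μ)
    (hind : iIndepFun X μ) (s : Finset E) (w t : ℝ) (ht0 : 0 ≤ t) (ht1 : t ≤ 1)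
    (hw : ∑ e ∈ s, (q e : ℝ) ≤ w) :
    μ.real {ω | t * w ≤ |∑ e ∈ s, (X e ω - q e)|} ≤ 2 * Real.exp (-(t ^ 2 * w / 3)) := by
  have key : ∀ σ : ℝ, |σ| = 1 → μ.real {ω | t * w ≤ σ * ∑ e ∈ s, (X e ω - q e)}
      ≤ Real.exp (-(t ^ 2 * w / 3)) := by
    intro σ hσ
    have h := measureReal_exists_increment_le X q hX hind (fun _ => (1 : Matrix Unit Unit ℝ))
      -- The size `2t/3` maximizes `c * t * w - 3/4 * c ^ 2 * w` over `c`, with maximum `t ^ 2 * w /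
      -- 3`.
      (by simp) (by simp) (fun _ => σ * (2 / 3 * t))
      (fun _ => by rw [abs_mul, hσ, one_mul, abs_of_nonneg (by positivity)]; linarith) s
      (t ^ 2 * w / 3)
    simp only [Fintype.card_unit, Nat.cast_one, one_mul] at h
    refine le_trans (measureReal_mono ?_) h
    intro ω hω
    refine ⟨1, by simp [dotProduct], ?_⟩
    have hs2 : σ ^ 2 = 1 := by rw [← sq_abs, hσ, one_pow]
    have e1 : (1 : Unit → ℝ) ⬝ᵥ (∑ e ∈ s,
          increment (1 : Matrix Unit Unit ℝ) (σ * (2 / 3 * t)) (q e) (X e ω)) *ᵥ 1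
        = 2 / 3 * t * (σ * ∑ e ∈ s, (X e ω - q e)) - t ^ 2 / 3 * ∑ e ∈ s, (q e : ℝ) := by
      simp only [dotProduct, Matrix.mulVec, increment, Matrix.sum_apply, Finset.univ_unique,
        Finset.sum_singleton, Pi.one_apply, one_mul, mul_one, Matrix.sub_apply, Matrix.smul_apply,
        Matrix.one_apply_eq, smul_eq_mul, mul_pow, hs2]
      rw [Finset.mul_sum, Finset.mul_sum, Finset.mul_sum, ← Finset.sum_sub_distrib]
      exact Finset.sum_congr rfl fun e _ => by ring
    rw [e1]
    have hω' : t * w ≤ σ * ∑ e ∈ s, (X e ω - q e) := hω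
    have h1 := mul_le_mul_of_nonneg_left hω' (by positivity : 0 ≤ 2 / 3 * t)
    have h2 := mul_le_mul_of_nonneg_left hw (by positivity : 0 ≤ t ^ 2 / 3)
    nlinarith
  have hsub : {ω | t * w ≤ |∑ e ∈ s, (X e ω - q e)|} ⊆
      {ω | t * w ≤ 1 * ∑ e ∈ s, (X e ω - q e)} ∪ {ω | t * w ≤ -1 * ∑ e ∈ s, (X e ω - q e)} := by
    intro ω hω
    rcases le_abs.1 (show t * w ≤ |∑ e ∈ s, (X e ω - q e)| from hω) with h | h
    · left; simpa using h
    · right; simpa using h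
  refine (measureReal_mono hsub).trans ((measureReal_union_le _ _).trans ?_)
  linarith [key 1 (by simp), key (-1) (by simp)]

end Tails

/-! ### The spectral norm of a random rectangular matrix -/

section Rectangular

variable {n p : ℕ} {Ω : Type*} [MeasurableSpace Ω]

theorem toLp_norm_sq {ι : Type*} [Fintype ι] (v : ι → ℝ) : ‖WithLp.toLp 2 v‖ ^ 2 = v ⬝ᵥ v := by
  rw [EuclideanSpace.real_norm_sq_eq]
  simp [dotProduct, pow_two]

theorem l2_opNorm_le_of_forall {m l : Type*} [Fintype m] [Fintype l] [DecidableEq l]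
    (A : Matrix m l ℝ) (a : ℝ) (ha : 0 ≤ a)
    (h : ∀ y : l → ℝ, (A *ᵥ y) ⬝ᵥ (A *ᵥ y) ≤ a ^ 2 * (y ⬝ᵥ y)) : ‖A‖ ≤ a := by
  rw [Matrix.l2_opNorm_def]
  refine ContinuousLinearMap.opNorm_le_bound _ ha fun y => ?_
  refine (sq_le_sq₀ (norm_nonneg _) (by positivity)).1 ?_
  rw [mul_pow]
  have := h y.ofLp
  rw [← toLp_norm_sq, ← toLp_norm_sq] at this
  exact this

theorem l2_opNorm_le_of_bilin {m l : Type*} [Fintype m] [Fintype l] [DecidableEq l]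
    (A : Matrix m l ℝ) (a : ℝ) (ha : 0 ≤ a)
    (h : ∀ (x : m → ℝ) (y : l → ℝ), 2 * (x ⬝ᵥ A *ᵥ y) ≤ a * (x ⬝ᵥ x + y ⬝ᵥ y)) : ‖A‖ ≤ a := by
  refine l2_opNorm_le_of_forall A a ha fun y => ?_
  rcases ha.eq_or_lt with rfl | ha'
  · have := h (A *ᵥ y) y
    linarith
  · have := h (a⁻¹ • (A *ᵥ y)) y
    simp only [smul_dotProduct, dotProduct_smul, smul_eq_mul] at this
    generalize (A *ᵥ y) ⬝ᵥ (A *ᵥ y) = N at *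
    generalize y ⬝ᵥ y = Y at *
    field_simp at this
    linarith

/-- The symmetric matrix of the edge between worker `i` and firm `j`. -/
def edgeMatrix (e : Fin n × Fin p) : Matrix (Fin n ⊕ Fin p) (Fin n ⊕ Fin p) ℝ :=
  Matrix.single (Sum.inl e.1) (Sum.inr e.2) 1 + Matrix.single (Sum.inr e.2) (Sum.inl e.1) 1

theorem edgeMatrix_transpose (e : Fin n × Fin p) : (edgeMatrix e)ᵀ = edgeMatrix e := by
  simp [edgeMatrix, add_comm]

theorem edgeMatrix_mul_self (e : Fin n × Fin p) : edgeMatrix e * edgeMatrix e =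
    Matrix.single (Sum.inl e.1) (Sum.inl e.1) 1 + Matrix.single (Sum.inr e.2) (Sum.inr e.2) 1 := by
  simp [edgeMatrix, add_mul, mul_add, add_comm]

/-- This is the cubic identity the Chernoff bound requires. The square being diagonal is what turns
the compensators into row and column sums. -/
theorem edgeMatrix_mul_mul (e : Fin n × Fin p) :
    edgeMatrix e * edgeMatrix e * edgeMatrix e = edgeMatrix e := by
  rw [edgeMatrix_mul_self]
  simp [edgeMatrix, add_mul, mul_add]

theorem dotProduct_increment_edgeMatrix (e : Fin n × Fin p) (u : Fin n ⊕ Fin p → ℝ) (c q x : ℝ) :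
    u ⬝ᵥ increment (edgeMatrix e) c q x *ᵥ u
      = 2 * (c * (x - q) * (u (Sum.inl e.1) * u (Sum.inr e.2)))
        - 3 / 4 * q * c ^ 2 * (u (Sum.inl e.1) ^ 2 + u (Sum.inr e.2) ^ 2) := by
  rw [increment, edgeMatrix_mul_self, edgeMatrix]
  simp only [Matrix.sub_mulVec, Matrix.smul_mulVec, Matrix.add_mulVec, dotProduct_sub,
    dotProduct_smul, dotProduct_add, smul_eq_mul, Matrix.single_mulVec]
  simp [dotProduct, Function.update_apply]
  ring

theorem measureReal_norm_gt_le {μ : Measure Ω} [IsProbabilityMeasure μ]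
    (X : Fin n × Fin p → Ω → ℝ) (q : Fin n × Fin p → unitInterval)
    (hX : ∀ e, HasLaw (X e) (bernoulliMeasure (1 : ℝ) 0 (q e)) μ) (hind : iIndepFun X μ)
    (r : Fin n → Fin p → ℝ) (M t : ℝ) (hM : 0 < M) (ht0 : 0 ≤ t) (ht1 : t ≤ 1)
    (hr0 : ∀ i j, 0 ≤ r i j) (hr : ∀ i j, r i j ≤ M)
    (hrow : ∀ i, ∑ j, (q (i, j) : ℝ) * r i j ^ 2 ≤ M)
    (hcol : ∀ j, ∑ i, (q (i, j) : ℝ) * r i j ^ 2 ≤ M) :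
    μ.real {ω | t < ‖Matrix.of fun i j => r i j * (X (i, j) ω - q (i, j))‖}
      ≤ (n + p) * Real.exp (-(t ^ 2 / (3 * M))) := by
  -- The maximizer of `θ * t - 3/4 * θ ^ 2 * M`, with value `t ^ 2 / (3 * M)`; as `r i j ≤ M`, the
  -- coefficients `θ * r i j` stay below `1`.
  set θ : ℝ := 2 * t / (3 * M) with hθ
  have hθ0 : 0 ≤ θ := by positivity
  have h := measureReal_exists_increment_le X q hX hind edgeMatrix edgeMatrix_transpose
    edgeMatrix_mul_mul (fun e => θ * r e.1 e.2) (fun e => by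
      rw [abs_of_nonneg (mul_nonneg hθ0 (hr0 _ _))]
      calc θ * r e.1 e.2 ≤ θ * M := mul_le_mul_of_nonneg_left (hr _ _) hθ0
        _ = 2 / 3 * t := by rw [hθ]; field_simp
        _ ≤ 1 := by linarith) Finset.univ (t ^ 2 / (3 * M))
  simp only [Fintype.card_sum, Fintype.card_fin, Nat.cast_add] at h
  refine le_trans (measureReal_mono ?_) h
  intro ω hω
  set Z : Matrix (Fin n) (Fin p) ℝ := Matrix.of fun i j => r i j * (X (i, j) ω - q (i, j)) with hZ
  have hω' : t < ‖Z‖ := hω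
  obtain ⟨x, y, hxy⟩ : ∃ (x : Fin n → ℝ) (y : Fin p → ℝ),
      t * (x ⬝ᵥ x + y ⬝ᵥ y) < 2 * (x ⬝ᵥ Z *ᵥ y) := by
    by_contra! hcon
    exact absurd (l2_opNorm_le_of_bilin Z t ht0 hcon) (not_le.2 hω')
  set N : ℝ := x ⬝ᵥ x + y ⬝ᵥ y with hN
  have hxx : 0 ≤ x ⬝ᵥ x := by rw [← toLp_norm_sq]; positivity
  have hyy : 0 ≤ y ⬝ᵥ y := by rw [← toLp_norm_sq]; positivity
  have hNpos : 0 < N := by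
    rcases (add_nonneg hxx hyy).eq_or_lt with h0 | h0
    · have hx0 : x = 0 := dotProduct_self_eq_zero.1 (by linarith)
      rw [hN, ← h0, hx0] at hxy
      simp at hxy
    · exact h0
  have hZq : x ⬝ᵥ Z *ᵥ y = ∑ i, ∑ j, r i j * (X (i, j) ω - q (i, j)) * (x i * y j) := by
    simp only [dotProduct, Matrix.mulVec, Finset.mul_sum, hZ, Matrix.of_apply]
    exact Finset.sum_congr rfl fun i _ => Finset.sum_congr rfl fun j _ => by ring
  have hvar : ∑ i, ∑ j, 3 / 4 * (q (i, j) : ℝ) * (θ * r i j) ^ 2 * (x i ^ 2 + y j ^ 2)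
      ≤ 3 / 4 * θ ^ 2 * M * N := by
    have h1 : ∑ i, ∑ j, (q (i, j) : ℝ) * r i j ^ 2 * x i ^ 2 ≤ M * (x ⬝ᵥ x) := by
      simp only [dotProduct, Finset.mul_sum, ← Finset.sum_mul]
      refine Finset.sum_le_sum fun i _ => ?_
      rw [← pow_two]
      exact mul_le_mul_of_nonneg_right (hrow i) (sq_nonneg _)
    have h2 : ∑ i, ∑ j, (q (i, j) : ℝ) * r i j ^ 2 * y j ^ 2 ≤ M * (y ⬝ᵥ y) := by
      rw [Finset.sum_comm]
      simp only [dotProduct, Finset.mul_sum, ← Finset.sum_mul]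
      refine Finset.sum_le_sum fun j _ => ?_
      rw [← pow_two]
      exact mul_le_mul_of_nonneg_right (hcol j) (sq_nonneg _)
    have h3 : ∑ i, ∑ j, 3 / 4 * (q (i, j) : ℝ) * (θ * r i j) ^ 2 * (x i ^ 2 + y j ^ 2)
        = 3 / 4 * θ ^ 2 * (∑ i, ∑ j, (q (i, j) : ℝ) * r i j ^ 2 * x i ^ 2
          + ∑ i, ∑ j, (q (i, j) : ℝ) * r i j ^ 2 * y j ^ 2) := by
      simp only [← Finset.sum_add_distrib, Finset.mul_sum]
      exact Finset.sum_congr rfl fun i _ => Finset.sum_congr rfl fun j _ => by ring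
    rw [h3, hN, mul_assoc (3 / 4 * θ ^ 2)]
    exact mul_le_mul_of_nonneg_left (by linarith) (by positivity)
  set v : Fin n ⊕ Fin p → ℝ := Sum.elim x y with hv
  have hvv : v ⬝ᵥ v = N := by simp [hv, hN, dotProduct]
  have hval : t ^ 2 / (3 * M) * N ≤ v ⬝ᵥ (∑ e,
      increment (edgeMatrix e) (θ * r e.1 e.2) (q e) (X e ω)) *ᵥ v := by
    rw [Matrix.sum_mulVec, dotProduct_sum, Fintype.sum_prod_type]
    simp only [dotProduct_increment_edgeMatrix, hv, Sum.elim_inl, Sum.elim_inr,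
      Finset.sum_sub_distrib]
    have h3 : ∑ i, ∑ j, 2 * (θ * r i j * (X (i, j) ω - q (i, j)) * (x i * y j))
        = θ * (2 * (x ⬝ᵥ Z *ᵥ y)) := by
      rw [hZq]
      simp only [Finset.mul_sum]
      exact Finset.sum_congr rfl fun i _ => Finset.sum_congr rfl fun j _ => by ring
    rw [h3]
    have h4 := mul_le_mul_of_nonneg_left hxy.le hθ0
    have h5 : t ^ 2 / (3 * M) * N = θ * (t * N) - 3 / 4 * θ ^ 2 * M * N := by
      rw [hθ]; field_simp; ring
    linarith
  refine ⟨(√N)⁻¹ • v, ?_, ?_⟩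
  · rw [smul_dotProduct, dotProduct_smul, hvv, smul_eq_mul, smul_eq_mul, ← mul_assoc, ← mul_inv,
      Real.mul_self_sqrt hNpos.le, inv_mul_cancel₀ hNpos.ne']
  · rw [Matrix.mulVec_smul, smul_dotProduct, dotProduct_smul, smul_eq_mul, smul_eq_mul, ← mul_assoc,
      ← mul_inv, Real.mul_self_sqrt hNpos.le, ← div_eq_inv_mul, le_div_iff₀ hNpos]
    exact hval

end Rectangular

/-! ### Perturbation of the inverse Laplacian of a weighted bipartite graph -/

section Perturbation

variable {n p : ℕ}

theorem l2_opNorm_transpose {m l : Type*} [Fintype m] [Fintype l] [DecidableEq m] [DecidableEq l]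
    (A : Matrix m l ℝ) : ‖Aᵀ‖ = ‖A‖ := by
  rw [← Matrix.conjTranspose_eq_transpose_of_trivial, Matrix.l2_opNorm_conjTranspose]

theorem l2_opNorm_diagonal_le {m : Type*} [Fintype m] [DecidableEq m] (v : m → ℝ) (c : ℝ)
    (hc : 0 ≤ c) (h : ∀ i, |v i| ≤ c) : ‖Matrix.diagonal v‖ ≤ c := by
  rw [Matrix.l2_opNorm_diagonal]
  exact (pi_norm_le_iff_of_nonneg hc).2 h

theorem inv_diagonal_of_ne_zero {m : Type*} [Fintype m] [DecidableEq m] (v : m → ℝ)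
    (h : ∀ i, v i ≠ 0) : (Matrix.diagonal v)⁻¹ = Matrix.diagonal fun i => (v i)⁻¹ := by
  refine Matrix.inv_eq_right_inv ?_
  rw [Matrix.diagonal_mul_diagonal, ← Matrix.diagonal_one]
  congr 1
  funext i
  exact mul_inv_cancel₀ (h i)

theorem isUnit_det_diagonal {m : Type*} [Fintype m] [DecidableEq m] (v : m → ℝ)
    (h : ∀ i, v i ≠ 0) : IsUnit (Matrix.diagonal v).det := by
  rw [Matrix.det_diagonal]
  exact isUnit_iff_ne_zero.2 (Finset.prod_ne_zero_iff.2 fun i _ => h i)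

theorem isUnit_det_of_coercive {m : Type*} [Fintype m] [DecidableEq m] (A : Matrix m m ℝ) (c : ℝ)
    (hc : 0 < c) (h : ∀ x : m → ℝ, c * (x ⬝ᵥ x) ≤ x ⬝ᵥ A *ᵥ x) : IsUnit A.det := by
  rw [isUnit_iff_ne_zero]
  intro h0
  obtain ⟨v, hv, hAv⟩ := Matrix.exists_mulVec_eq_zero_iff.2 h0
  have h1 := h v
  rw [hAv, dotProduct_zero] at h1
  have h2 : 0 ≤ v ⬝ᵥ v := by rw [← toLp_norm_sq]; positivity
  exact hv (dotProduct_self_eq_zero.1 (le_antisymm (by nlinarith) h2))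

theorem norm_inv_le_of_coercive {m : Type*} [Fintype m] [DecidableEq m] (A : Matrix m m ℝ) (c : ℝ)
    (hc : 0 < c) (h : ∀ x : m → ℝ, c * (x ⬝ᵥ x) ≤ x ⬝ᵥ A *ᵥ x) : ‖A⁻¹‖ ≤ c⁻¹ := by
  refine l2_opNorm_le_of_forall _ _ (by positivity) fun y => ?_
  set x := A⁻¹ *ᵥ y with hx
  have hAx : A *ᵥ x = y := by
    rw [hx, Matrix.mulVec_mulVec, Matrix.mul_nonsing_inv _ (isUnit_det_of_coercive A c hc h),
      Matrix.one_mulVec]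
  have h1 := h x
  rw [hAx] at h1
  -- Expanding this square and using `c * |x|² ≤ x·y` yields `c² * |x|² ≤ |y|²`.
  have h2 : 0 ≤ (c • x - y) ⬝ᵥ (c • x - y) := by rw [← toLp_norm_sq]; positivity
  simp only [sub_dotProduct, dotProduct_sub, smul_dotProduct, dotProduct_smul, smul_eq_mul,
    dotProduct_comm y x] at h2
  rw [inv_pow, ← div_eq_inv_mul, le_div_iff₀ (by positivity)]
  nlinarith

/-- Cauchy–Schwarz in each worker's row bounds the Gram term by the unregularized firm degree form,
leaving only the ridge. -/
theorem dotProduct_unnormLf_ge (B : Matrix (Fin n) (Fin p) ℝ) (hB : ∀ i j, 0 ≤ B i j)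
    (lamW lamF : ℝ) (hlamW : 0 ≤ lamW) (hw : ∀ i, 0 < workerDegree B i + lamW) (x : Fin p → ℝ) :
    lamF * (x ⬝ᵥ x) ≤ x ⬝ᵥ unnormLf B lamW lamF *ᵥ x := by
  have h1 : x ⬝ᵥ Df B lamF *ᵥ x = ∑ i, ∑ j, B i j * x j ^ 2 + lamF * (x ⬝ᵥ x) := by
    rw [Finset.sum_comm]
    simp only [Df, dotProduct, Matrix.mulVec_diagonal, Finset.mul_sum, ← Finset.sum_add_distrib]
    refine Finset.sum_congr rfl fun j _ => ?_
    rw [← Finset.sum_mul]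
    simp only [firmDegree]
    ring
  have h2 : x ⬝ᵥ (Bᵀ * (Dw B lamW)⁻¹ * B) *ᵥ x
      = ∑ i, (workerDegree B i + lamW)⁻¹ * (B *ᵥ x) i ^ 2 := by
    rw [Dw, inv_diagonal_of_ne_zero _ fun i => (hw i).ne', ← Matrix.mulVec_mulVec,
      ← Matrix.mulVec_mulVec, Matrix.dotProduct_mulVec, Matrix.vecMul_transpose]
    simp only [dotProduct, Matrix.mulVec_diagonal]
    exact Finset.sum_congr rfl fun i _ => by ring
  have h3 : ∀ i, (workerDegree B i + lamW)⁻¹ * (B *ᵥ x) i ^ 2 ≤ ∑ j, B i j * x j ^ 2 := by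
    intro i
    rw [← div_eq_inv_mul, div_le_iff₀ (hw i)]
    have hnn : 0 ≤ ∑ j, B i j * x j ^ 2 :=
      Finset.sum_nonneg fun j _ => mul_nonneg (hB i j) (sq_nonneg _)
    have hcs : (B *ᵥ x) i ^ 2 ≤ (∑ j, B i j) * ∑ j, B i j * x j ^ 2 := by
      simp only [Matrix.mulVec, dotProduct]
      exact Finset.sum_sq_le_sum_mul_sum_of_sq_le_mul _ (fun j _ => hB i j)
        (fun j _ => mul_nonneg (hB i j) (sq_nonneg _)) fun j _ => le_of_eq (by ring)
    have : (∑ j, B i j) ≤ workerDegree B i + lamW := by simp only [workerDegree]; linarith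
    rw [mul_comm]
    exact hcs.trans (mul_le_mul_of_nonneg_right this hnn)
  rw [unnormLf, Matrix.sub_mulVec, dotProduct_sub, h1, h2]
  have := Finset.sum_le_sum fun i (_ : i ∈ Finset.univ) => h3 i
  linarith

/-- Apply `2ab ≤ a² + b²` on each edge; the row and column sums then cancel the degrees, and the
ridge only helps. -/
theorem norm_normalized_le_one (B : Matrix (Fin n) (Fin p) ℝ) (hB : ∀ i j, 0 ≤ B i j)
    (lamW lamF : ℝ) (hlamW : 0 ≤ lamW) (hlamF : 0 ≤ lamF)
    (hw : ∀ i, 0 < workerDegree B i + lamW) (hf : ∀ j, 0 < firmDegree B j + lamF) :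
    ‖DwInvSqrt B lamW * B * DfInvSqrt B lamF‖ ≤ 1 := by
  refine l2_opNorm_le_of_bilin _ 1 zero_le_one fun x y => ?_
  have h1 : x ⬝ᵥ (DwInvSqrt B lamW * B * DfInvSqrt B lamF) *ᵥ y
      = ∑ i, ∑ j, B i j * (x i * (√(workerDegree B i + lamW))⁻¹
        * (y j * (√(firmDegree B j + lamF))⁻¹)) := by
    simp only [DwInvSqrt, DfInvSqrt, dotProduct, Matrix.mulVec, Matrix.mul_diagonal,
      Matrix.diagonal_mul, Finset.mul_sum]
    exact Finset.sum_congr rfl fun i _ => Finset.sum_congr rfl fun j _ => by ring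
  have hsq : ∀ d z : ℝ, 0 < d → (z * (√d)⁻¹) ^ 2 = z ^ 2 / d := fun d z hd => by
    rw [mul_pow, inv_pow, Real.sq_sqrt hd.le, div_eq_mul_inv]
  have h2 : 2 * (x ⬝ᵥ (DwInvSqrt B lamW * B * DfInvSqrt B lamF) *ᵥ y)
      ≤ ∑ i, ∑ j, B i j * (x i ^ 2 / (workerDegree B i + lamW))
        + ∑ i, ∑ j, B i j * (y j ^ 2 / (firmDegree B j + lamF)) := by
    rw [h1, Finset.mul_sum, ← Finset.sum_add_distrib]
    refine Finset.sum_le_sum fun i _ => ?_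
    rw [Finset.mul_sum, ← Finset.sum_add_distrib]
    refine Finset.sum_le_sum fun j _ => ?_
    rw [← hsq _ _ (hw i), ← hsq _ _ (hf j), ← mul_add, mul_left_comm]
    refine mul_le_mul_of_nonneg_left ?_ (hB i j)
    rw [← mul_assoc]
    exact two_mul_le_add_sq _ _
  have hdiv : ∀ s l z : ℝ, 0 ≤ l → 0 < s + l → s * (z ^ 2 / (s + l)) ≤ z * z := by
    intro s l z hl hs
    rw [← mul_div_assoc, div_le_iff₀ hs]
    nlinarith [sq_nonneg z]
  have h3 : ∑ i, ∑ j, B i j * (x i ^ 2 / (workerDegree B i + lamW)) ≤ x ⬝ᵥ x := by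
    refine Finset.sum_le_sum fun i _ => ?_
    rw [← Finset.sum_mul]
    exact hdiv _ _ _ hlamW (hw i)
  have h4 : ∑ i, ∑ j, B i j * (y j ^ 2 / (firmDegree B j + lamF)) ≤ y ⬝ᵥ y := by
    rw [Finset.sum_comm]
    refine Finset.sum_le_sum fun j _ => ?_
    rw [← Finset.sum_mul]
    exact hdiv _ _ _ hlamF (hf j)
  linarith

theorem unnormLf_inv_eq (B : Matrix (Fin n) (Fin p) ℝ) (lamW lamF : ℝ)
    (hf : ∀ j, 0 < firmDegree B j + lamF) :
    (unnormLf B lamW lamF)⁻¹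
      = DfInvSqrt B lamF * (normLf B lamW lamF)⁻¹ * DfInvSqrt B lamF := by
  have hne : ∀ j, (√(firmDegree B j + lamF))⁻¹ ≠ 0 := fun j =>
    inv_ne_zero (Real.sqrt_pos.2 (hf j)).ne'
  have hu : IsUnit (DfInvSqrt B lamF).det := isUnit_det_diagonal _ hne
  have h1 : DfInvSqrt B lamF * Df B lamF * DfInvSqrt B lamF = 1 := by
    simp only [DfInvSqrt, Df, Matrix.diagonal_mul_diagonal]
    rw [← Matrix.diagonal_one]
    congr 1
    funext j
    have := Real.mul_self_sqrt (hf j).le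
    have := (Real.sqrt_pos.2 (hf j)).ne'
    field_simp
    linarith
  have h2 : normLf B lamW lamF = DfInvSqrt B lamF * unnormLf B lamW lamF * DfInvSqrt B lamF := by
    rw [normLf, unnormLf, Matrix.mul_sub, Matrix.sub_mul, h1]
  rw [h2, Matrix.mul_inv_rev, Matrix.mul_inv_rev, ← mul_assoc, ← mul_assoc,
    Matrix.mul_nonsing_inv _ hu, one_mul, mul_assoc, Matrix.nonsing_inv_mul _ hu, mul_one]

/-- `BᵀD_w⁻¹B` in terms of the normalization of `B` by the degrees of a second graph `P`. -/
theorem transpose_mul_inv_mul_eq (P B : Matrix (Fin n) (Fin p) ℝ) (lamW lamF : ℝ)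
    (hw : ∀ i, 0 < workerDegree P i + lamW) (hf : ∀ j, 0 < firmDegree P j + lamF)
    (hwB : ∀ i, 0 < workerDegree B i + lamW) :
    Bᵀ * (Dw B lamW)⁻¹ * B = Matrix.diagonal (fun j => √(firmDegree P j + lamF))
      * ((DwInvSqrt P lamW * B * DfInvSqrt P lamF)ᵀ
        * Matrix.diagonal (fun i => (workerDegree P i + lamW) / (workerDegree B i + lamW))
        * (DwInvSqrt P lamW * B * DfInvSqrt P lamF))
      * Matrix.diagonal (fun j => √(firmDegree P j + lamF)) := by
  set Q := Matrix.diagonal fun j => √(firmDegree P j + lamF) with hQ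
  set E := Matrix.diagonal fun i => (workerDegree P i + lamW) / (workerDegree B i + lamW) with hE
  have hSQ : DfInvSqrt P lamF * Q = 1 := by
    rw [DfInvSqrt, hQ, Matrix.diagonal_mul_diagonal, ← Matrix.diagonal_one]
    congr 1
    funext j
    exact inv_mul_cancel₀ (Real.sqrt_pos.2 (hf j)).ne'
  have hQS : Q * DfInvSqrt P lamF = 1 := mul_eq_one_comm.1 hSQ
  have hSES : DwInvSqrt P lamW * E * DwInvSqrt P lamW = (Dw B lamW)⁻¹ := by
    rw [Dw, inv_diagonal_of_ne_zero _ fun i => (hwB i).ne', DwInvSqrt, hE,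
      Matrix.diagonal_mul_diagonal, Matrix.diagonal_mul_diagonal]
    congr 1
    funext i
    have h1 := Real.sq_sqrt (hw i).le
    have h2 := (Real.sqrt_pos.2 (hw i)).ne'
    have h3 := (hwB i).ne'
    field_simp
    exact h1.symm
  have ht : (DwInvSqrt P lamW * B * DfInvSqrt P lamF)ᵀ
      = DfInvSqrt P lamF * Bᵀ * DwInvSqrt P lamW := by
    rw [Matrix.transpose_mul, Matrix.transpose_mul, DwInvSqrt, DfInvSqrt,
      Matrix.diagonal_transpose, Matrix.diagonal_transpose, Matrix.mul_assoc]
  calc Bᵀ * (Dw B lamW)⁻¹ * B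
      = (Q * DfInvSqrt P lamF) * Bᵀ * (DwInvSqrt P lamW * E * DwInvSqrt P lamW) * B
          * (DfInvSqrt P lamF * Q) := by
        rw [hQS, hSQ, hSES, Matrix.one_mul, Matrix.mul_one]
    _ = _ := by rw [ht]; simp only [Matrix.mul_assoc]

theorem norm_sqrt_conj_le {m : Type*} [Fintype m] [DecidableEq m] (d : m → ℝ) (hd : ∀ j, 0 < d j)
    (X : Matrix m m ℝ) :
    ‖Matrix.diagonal (fun j => √(d j)) * X * Matrix.diagonal (fun j => √(d j))‖
      ≤ ‖Matrix.diagonal d‖ * ‖X‖ := by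
  set Q := Matrix.diagonal fun j => √(d j) with hQ
  have h1 : ‖Q‖ * ‖Q‖ = ‖Matrix.diagonal d‖ := by
    rw [← Matrix.l2_opNorm_conjTranspose_mul_self, Matrix.conjTranspose_eq_transpose_of_trivial,
      hQ, Matrix.diagonal_transpose, Matrix.diagonal_mul_diagonal]
    congr 2
    funext j
    exact Real.mul_self_sqrt (hd j).le
  calc ‖Q * X * Q‖ ≤ ‖Q‖ * ‖X‖ * ‖Q‖ :=
        (norm_mul_le _ _).trans (mul_le_mul_of_nonneg_right (norm_mul_le _ _) (norm_nonneg _))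
    _ = ‖Matrix.diagonal d‖ * ‖X‖ := by rw [← h1]; ring

theorem diagonal_div_self {m : Type*} [DecidableEq m] (d : m → ℝ) (hd : ∀ i, 0 < d i) :
    Matrix.diagonal (fun i => d i / d i) = (1 : Matrix m m ℝ) := by
  rw [← Matrix.diagonal_one]
  congr 1
  funext i
  exact div_self (hd i).ne'

theorem norm_unnormLf_le (C : Matrix (Fin n) (Fin p) ℝ) (hC : ∀ i j, 0 ≤ C i j)
    (lamW lamF : ℝ) (hlamW : 0 ≤ lamW) (hlamF : 0 ≤ lamF)
    (hw : ∀ i, 0 < workerDegree C i + lamW) (hf : ∀ j, 0 < firmDegree C j + lamF) :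
    ‖unnormLf C lamW lamF‖ ≤ 2 * ‖Df C lamF‖ := by
  have h1 := norm_sqrt_conj_le _ hf ((DwInvSqrt C lamW * C * DfInvSqrt C lamF)ᵀ
    * Matrix.diagonal (fun i => (workerDegree C i + lamW) / (workerDegree C i + lamW))
    * (DwInvSqrt C lamW * C * DfInvSqrt C lamF))
  rw [← transpose_mul_inv_mul_eq C C lamW lamF hw hf hw] at h1
  have h2 := norm_normalized_le_one C hC lamW lamF hlamW hlamF hw hf
  rw [diagonal_div_self _ hw, Matrix.mul_one] at h1
  have h4 : ‖(DwInvSqrt C lamW * C * DfInvSqrt C lamF)ᵀ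
      * (DwInvSqrt C lamW * C * DfInvSqrt C lamF)‖ ≤ 1 := by
    refine (Matrix.l2_opNorm_mul _ _).trans ?_
    rw [l2_opNorm_transpose]
    exact mul_le_one₀ h2 (norm_nonneg _) h2
  have h5 := mul_le_mul_of_nonneg_left h4 (norm_nonneg (Df C lamF))
  rw [unnormLf]
  refine (norm_sub_le _ _).trans ?_
  rw [Df] at h5 ⊢
  linarith

theorem norm_gram_perturb_le {m l : Type*} [Fintype m] [Fintype l] [DecidableEq m] [DecidableEq l]
    (A Z : Matrix m l ℝ) (E : Matrix m m ℝ) (t : ℝ) (ht : t ≤ 1 / 2) (hA : ‖A‖ ≤ 1)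
    (hZ : ‖Z‖ ≤ t) (hE : ‖E - 1‖ ≤ 2 * t) :
    ‖(A + Z)ᵀ * E * (A + Z) - Aᵀ * A‖ ≤ 7 * t := by
  have ht0 : 0 ≤ t := (norm_nonneg _).trans hZ
  -- The three terms contribute `9t/2`, `3t/2` and `t`, using `‖A + Z‖ ≤ 3/2`.
  have hsplit : (A + Z)ᵀ * E * (A + Z) - Aᵀ * A
      = (A + Z)ᵀ * (E - 1) * (A + Z) + ((A + Z)ᵀ * Z + Zᵀ * A) := by
    simp only [Matrix.transpose_add, Matrix.mul_sub, Matrix.sub_mul, Matrix.mul_add, Matrix.add_mul,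
      Matrix.mul_one]
    abel
  have hA' : ‖A + Z‖ ≤ 3 / 2 := (norm_add_le _ _).trans (by linarith)
  have hA't : ‖(A + Z)ᵀ‖ ≤ 3 / 2 := by rwa [l2_opNorm_transpose]
  have g1 : ‖(A + Z)ᵀ * (E - 1) * (A + Z)‖ ≤ 3 / 2 * (2 * t) * (3 / 2) :=
    (Matrix.l2_opNorm_mul _ _).trans (mul_le_mul
      ((Matrix.l2_opNorm_mul _ _).trans (mul_le_mul hA't hE (norm_nonneg _) (by norm_num)))
      hA' (norm_nonneg _) (by positivity))
  have g2 : ‖(A + Z)ᵀ * Z‖ ≤ 3 / 2 * t :=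
    (Matrix.l2_opNorm_mul _ _).trans (mul_le_mul hA't hZ (norm_nonneg _) (by norm_num))
  have g3 : ‖Zᵀ * A‖ ≤ t * 1 :=
    (Matrix.l2_opNorm_mul _ _).trans (mul_le_mul (by rwa [l2_opNorm_transpose]) hA
      (norm_nonneg _) ht0)
  rw [hsplit]
  refine (norm_add_le _ _).trans ((add_le_add g1 ((norm_add_le _ _).trans
    (add_le_add g2 g3))).trans ?_)
  linarith

theorem norm_unnormLf_sub_le (P B : Matrix (Fin n) (Fin p) ℝ) (hP : ∀ i j, 0 ≤ P i j)
    (hB : ∀ i j, 0 ≤ B i j) (lamW lamF : ℝ) (hlamW : 0 ≤ lamW) (hlamF : 0 < lamF)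
    (hw : ∀ i, 0 < workerDegree P i + lamW) (t F : ℝ) (ht0 : 0 ≤ t) (ht1 : t ≤ 1)
    (hF0 : 0 ≤ F) (hF : ∀ j, firmDegree P j + lamF ≤ F)
    (hdw : ∀ i, |workerDegree B i - workerDegree P i| < t * (workerDegree P i + lamW))
    (hdf : ∀ j, |firmDegree B j - firmDegree P j| < t * (firmDegree P j + lamF))
    (hZ : ‖DwInvSqrt P lamW * (B - P) * DfInvSqrt P lamF‖ ≤ t) :
    ‖unnormLf B lamW lamF - unnormLf P lamW lamF‖ ≤ 21 * t * F := by
  have hdeg : ∀ B : Matrix (Fin n) (Fin p) ℝ, (∀ i j, 0 ≤ B i j) → ∀ j,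
      0 < firmDegree B j + lamF := fun B hB j =>
    add_pos_of_nonneg_of_pos (Finset.sum_nonneg fun i _ => hB i j) hlamF
  have hf := hdeg P hP
  have hfB := hdeg B hB
  have hwB : ∀ i, 0 < workerDegree B i + lamW := fun i => by
    have h1 := (abs_lt.1 (hdw i)).1
    have h2 := mul_le_mul_of_nonneg_right ht1 (hw i).le
    linarith
  have hDsub : ‖Df B lamF - Df P lamF‖ ≤ t * F := by
    rw [Df, Df, Matrix.diagonal_sub]
    refine l2_opNorm_diagonal_le _ _ (by positivity) fun j => ?_
    rw [add_sub_add_right_eq_sub]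
    exact (hdf j).le.trans (mul_le_mul_of_nonneg_left (hF j) ht0)
  have hDP : ‖Df P lamF‖ ≤ F := by
    refine l2_opNorm_diagonal_le _ _ hF0 fun j => ?_
    rw [abs_of_pos (hf j)]
    exact hF j
  have hDB : ‖Df B lamF‖ ≤ (1 + t) * F := by
    have : Df B lamF = (Df B lamF - Df P lamF) + Df P lamF := by abel
    rw [this]
    exact (norm_add_le _ _).trans (by linarith)
  have htF : 0 ≤ t * F := by positivity
  -- For `t ≥ 1/2` the triangle inequality suffices, since `F ≤ 2 * t * F`. For smaller `t` the
  -- random worker degrees are at least half the expected ones, which controls `E - 1`; that case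
  -- gives `8 * t * F`.
  rcases le_or_gt (1 / 2) t with ht | ht
  · have h1 := norm_unnormLf_le B hB lamW lamF hlamW hlamF.le hwB hfB
    have h2 := norm_unnormLf_le P hP lamW lamF hlamW hlamF.le hw hf
    have h3 : F ≤ 2 * (t * F) := by nlinarith
    refine (norm_sub_le _ _).trans ?_
    nlinarith
  · set A := DwInvSqrt P lamW * P * DfInvSqrt P lamF with hA
    set Z := DwInvSqrt P lamW * (B - P) * DfInvSqrt P lamF with hZdef
    set A' := DwInvSqrt P lamW * B * DfInvSqrt P lamF with hA'
    set E := Matrix.diagonal fun i => (workerDegree P i + lamW) / (workerDegree B i + lamW) with hE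
    set Q := Matrix.diagonal fun j => √(firmDegree P j + lamF) with hQdef
    have hAZ : A' = A + Z := by
      rw [hA', hA, hZdef, Matrix.mul_sub, Matrix.sub_mul]; abel
    have hAn : ‖A‖ ≤ 1 := norm_normalized_le_one P hP lamW lamF hlamW hlamF.le hw hf
    have hEn : ‖E - 1‖ ≤ 2 * t := by
      rw [hE, ← Matrix.diagonal_one, Matrix.diagonal_sub]
      refine l2_opNorm_diagonal_le _ _ (by positivity) fun i => ?_
      have h1 := abs_lt.1 (hdw i)
      have h2 : (workerDegree P i + lamW) / 2 ≤ workerDegree B i + lamW := by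
        nlinarith [hw i]
      rw [div_sub_one (hwB i).ne', abs_div, abs_of_pos (hwB i), div_le_iff₀ (hwB i),
        add_sub_add_right_eq_sub, abs_sub_comm]
      nlinarith [hdw i]
    have hB' := transpose_mul_inv_mul_eq P B lamW lamF hw hf hwB
    have hP' := transpose_mul_inv_mul_eq P P lamW lamF hw hf hw
    rw [diagonal_div_self _ hw, Matrix.mul_one] at hP'
    have hn : ‖A'ᵀ * E * A' - Aᵀ * A‖ ≤ 7 * t := by
      rw [hAZ]
      exact norm_gram_perturb_le A Z E t ht.le hAn hZ hEn
    have hfin : unnormLf B lamW lamF - unnormLf P lamW lamF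
        = (Df B lamF - Df P lamF) - Q * (A'ᵀ * E * A' - Aᵀ * A) * Q := by
      rw [unnormLf, unnormLf, hB', hP', Matrix.mul_sub Q, Matrix.sub_mul]
      abel
    rw [hfin]
    have h6 : ‖Q * (A'ᵀ * E * A' - Aᵀ * A) * Q‖ ≤ ‖Df P lamF‖ * ‖A'ᵀ * E * A' - Aᵀ * A‖ :=
      norm_sqrt_conj_le _ hf _
    have h7 := mul_le_mul hDP hn (norm_nonneg _) hF0
    refine (norm_sub_le _ _).trans ?_
    linarith

theorem unnormLf_inv_sub_bound (P B : Matrix (Fin n) (Fin p) ℝ) (hP : ∀ i j, 0 ≤ P i j)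
    (hB : ∀ i j, 0 ≤ B i j) (lamW lamF : ℝ) (hlamW : 0 ≤ lamW) (hlamF : 0 < lamF)
    (hw : ∀ i, 0 < workerDegree P i + lamW) (t F : ℝ) (ht0 : 0 ≤ t) (ht1 : t ≤ 1)
    (hF0 : 0 ≤ F) (hF : ∀ j, firmDegree P j + lamF ≤ F)
    (hdw : ∀ i, |workerDegree B i - workerDegree P i| < t * (workerDegree P i + lamW))
    (hdf : ∀ j, |firmDegree B j - firmDegree P j| < t * (firmDegree P j + lamF))
    (hZ : ‖DwInvSqrt P lamW * (B - P) * DfInvSqrt P lamF‖ ≤ t) :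
    IsUnit (Dw B lamW).det ∧ IsUnit (unnormLf B lamW lamF).det ∧
      ‖(unnormLf B lamW lamF)⁻¹ - (unnormLf P lamW lamF)⁻¹‖
        = ‖DfInvSqrt B lamF * (normLf B lamW lamF)⁻¹ * DfInvSqrt B lamF
          - DfInvSqrt P lamF * (normLf P lamW lamF)⁻¹ * DfInvSqrt P lamF‖ ∧
      ‖(unnormLf B lamW lamF)⁻¹ - (unnormLf P lamW lamF)⁻¹‖ ≤ 21 * (F / lamF ^ 2) * t := by
  have hdeg : ∀ B : Matrix (Fin n) (Fin p) ℝ, (∀ i j, 0 ≤ B i j) → ∀ j,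
      0 < firmDegree B j + lamF := fun B hB j =>
    add_pos_of_nonneg_of_pos (Finset.sum_nonneg fun i _ => hB i j) hlamF
  have hwB : ∀ i, 0 < workerDegree B i + lamW := fun i => by
    have h1 := (abs_lt.1 (hdw i)).1
    have h2 := mul_le_mul_of_nonneg_right ht1 (hw i).le
    linarith
  have qB := dotProduct_unnormLf_ge B hB lamW lamF hlamW hwB
  have qP := dotProduct_unnormLf_ge P hP lamW lamF hlamW hw
  have uB := isUnit_det_of_coercive _ _ hlamF qB
  have uP := isUnit_det_of_coercive _ _ hlamF qP
  refine ⟨isUnit_det_diagonal _ fun i => (hwB i).ne', uB, ?_, ?_⟩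
  · rw [unnormLf_inv_eq B lamW lamF (hdeg B hB), unnormLf_inv_eq P lamW lamF (hdeg P hP)]
  · have h1 : (unnormLf B lamW lamF)⁻¹ - (unnormLf P lamW lamF)⁻¹
        = -((unnormLf B lamW lamF)⁻¹ * (unnormLf B lamW lamF - unnormLf P lamW lamF)
          * (unnormLf P lamW lamF)⁻¹) := by
      rw [Matrix.mul_sub, Matrix.sub_mul, Matrix.nonsing_inv_mul _ uB, mul_assoc,
        Matrix.mul_nonsing_inv _ uP, one_mul, mul_one, neg_sub]
    rw [h1, norm_neg]
    have h2 := norm_unnormLf_sub_le P B hP hB lamW lamF hlamW hlamF hw t F ht0 ht1 hF0 hF hdw hdf hZ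
    calc _ ≤ lamF⁻¹ * (21 * t * F) * lamF⁻¹ := by
          refine (norm_mul_le _ _).trans (mul_le_mul ((norm_mul_le _ _).trans (mul_le_mul
            (norm_inv_le_of_coercive _ _ hlamF qB) h2 (norm_nonneg _) (by positivity)))
            (norm_inv_le_of_coercive _ _ hlamF qP) (norm_nonneg _) (by positivity))
      _ = 21 * (F / lamF ^ 2) * t := by field_simp

end Perturbation

/-! ### The concentration event -/

section Event

variable {n p K : ℕ} (m : BlockModel n p K) {Ω : Type*} [MeasurableSpace Ω]

theorem BlockModel.expB_nonneg (i : Fin n) (j : Fin p) : 0 ≤ m.expB i j := (m.prob i j).2.1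

theorem inv_sqrt_mul_inv_sqrt_le (w f M : ℝ) (hw : 0 < w) (hf : 0 < f) (hMw : 1 ≤ M * w)
    (hMf : 1 ≤ M * f) : (√w)⁻¹ * (√f)⁻¹ ≤ M := by
  have h0 : 0 < M := by by_contra! h; nlinarith
  rw [← mul_inv, ← Real.sqrt_mul hw.le, inv_le_comm₀ (by positivity) h0]
  refine Real.le_sqrt_of_sq_le ?_
  rw [inv_pow, inv_le_iff_one_le_mul₀ (by positivity)]
  nlinarith

/-- The weights `q j / w` sum to at most one and each `1 / d j` is at most `M`. This bounds the row
and column variances of the normalized matrix. -/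
theorem sum_mul_inv_sqrt_sq_le {ι : Type*} [Fintype ι] (q d : ι → ℝ) (w M l : ℝ)
    (hq : ∀ j, 0 ≤ q j) (hl : 0 ≤ l) (hw : 0 < w) (hd : ∀ j, 0 < d j) (hM : ∀ j, 1 ≤ M * d j)
    (hM0 : 0 ≤ M) (hsum : ∑ j, q j + l = w) :
    ∑ j, q j * ((√w)⁻¹ * (√(d j))⁻¹) ^ 2 ≤ M := by
  have h1 : ∀ j, q j * ((√w)⁻¹ * (√(d j))⁻¹) ^ 2 ≤ q j * (w⁻¹ * M) := by
    intro j
    refine mul_le_mul_of_nonneg_left ?_ (hq j)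
    rw [mul_pow, inv_pow, inv_pow, Real.sq_sqrt hw.le, Real.sq_sqrt (hd j).le]
    refine mul_le_mul_of_nonneg_left ?_ (by positivity)
    rw [inv_le_iff_one_le_mul₀ (hd j)]
    exact hM j
  refine (Finset.sum_le_sum fun j _ => h1 j).trans ?_
  rw [← Finset.sum_mul, ← mul_assoc]
  refine mul_le_of_le_one_left hM0 ?_
  rw [← div_eq_mul_inv, div_le_one hw]
  linarith

theorem measureReal_good_event {μ : Measure Ω} [IsProbabilityMeasure μ]
    (B : Ω → Matrix (Fin n) (Fin p) ℝ) (hB : m.IsNetwork μ B) (lamW lamF : ℝ) (hlamW : 0 ≤ lamW)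
    (hlamF : 0 ≤ lamF) (M t L : ℝ) (hM : 0 < M)
    (hw : ∀ i, 0 < workerDegree m.expB i + lamW) (hf : ∀ j, 0 < firmDegree m.expB j + lamF)
    (hMw : ∀ i, 1 ≤ M * (workerDegree m.expB i + lamW))
    (hMf : ∀ j, 1 ≤ M * (firmDegree m.expB j + lamF))
    (ht0 : 0 ≤ t) (ht1 : t ≤ 1) (hL : 0 ≤ L) (htL : t ^ 2 = 3 * M * L) :
    1 - 3 * ((n + p) * Real.exp (-L)) ≤ μ.real {ω | (∀ i j, 0 ≤ B ω i j) ∧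
      (∀ i, |workerDegree (B ω) i - workerDegree m.expB i|
        < t * (workerDegree m.expB i + lamW)) ∧
      (∀ j, |firmDegree (B ω) j - firmDegree m.expB j| < t * (firmDegree m.expB j + lamF)) ∧
      ‖DwInvSqrt m.expB lamW * (B ω - m.expB) * DfInvSqrt m.expB lamF‖ ≤ t} := by
  set X : Fin n × Fin p → Ω → ℝ := fun e ω => B ω e.1 e.2 with hX
  set q : Fin n × Fin p → unitInterval := fun e => m.prob e.1 e.2 with hq
  have hlaw : ∀ e, HasLaw (X e) (bernoulliMeasure (1 : ℝ) 0 (q e)) μ := fun e => hB.hasLaw e.1 e.2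
  have hind : iIndepFun X μ := hB.indep
  set w : Fin n → ℝ := fun i => workerDegree m.expB i + lamW with hwdef
  set f : Fin p → ℝ := fun j => firmDegree m.expB j + lamF with hfdef
  set U : Set Ω := {ω | ¬ ∀ i j, 0 ≤ B ω i j} with hU
  set W : Fin n → Set Ω :=
    fun i => {ω | t * w i ≤ |workerDegree (B ω) i - workerDegree m.expB i|} with hW
  set F : Fin p → Set Ω :=
    fun j => {ω | t * f j ≤ |firmDegree (B ω) j - firmDegree m.expB j|} with hF
  set Z : Set Ω :=
    {ω | t < ‖DwInvSqrt m.expB lamW * (B ω - m.expB) * DfInvSqrt m.expB lamF‖} with hZ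
  -- By the choice of `t`, the exponent `t ^ 2 * d / 3` equals `M * d * L`, which is at least `L`.
  have hexp : ∀ d : ℝ, 1 ≤ M * d → 2 * Real.exp (-(t ^ 2 * d / 3)) ≤ 2 * Real.exp (-L) := by
    intro d hd
    refine mul_le_mul_of_nonneg_left (Real.exp_le_exp.2 ?_) (by norm_num)
    rw [htL]
    nlinarith
  have mU : μ.real U = 0 := by
    rw [measureReal_eq_zero_iff]
    have : ∀ᵐ ω ∂μ, ∀ i j, 0 ≤ B ω i j := by
      refine ae_all_iff.2 fun i => ae_all_iff.2 fun j => ?_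
      filter_upwards [ae_mem_Icc_of_hasLaw (hB.hasLaw i j)] with ω hω
      rcases hω with h | h <;> simp [h]
    exact this
  have mW : ∀ i, μ.real (W i) ≤ 2 * Real.exp (-L) := by
    intro i
    have h := measureReal_abs_sum_ge_le X q hlaw hind (Finset.univ.map
      ⟨fun j => (i, j), fun _ _ h => (Prod.ext_iff.1 h).2⟩) (w i) t ht0 ht1 (by
        rw [Finset.sum_map]
        exact le_add_of_nonneg_right hlamW)
    refine le_trans (le_of_eq ?_) (h.trans (hexp _ (hMw i)))
    simp only [Finset.sum_map, Finset.sum_sub_distrib]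
    rfl
  have mF : ∀ j, μ.real (F j) ≤ 2 * Real.exp (-L) := by
    intro j
    have h := measureReal_abs_sum_ge_le X q hlaw hind (Finset.univ.map
      ⟨fun i => (i, j), fun _ _ h => (Prod.ext_iff.1 h).1⟩) (f j) t ht0 ht1 (by
        rw [Finset.sum_map]
        exact le_add_of_nonneg_right hlamF)
    refine le_trans (le_of_eq ?_) (h.trans (hexp _ (hMf j)))
    simp only [Finset.sum_map, Finset.sum_sub_distrib]
    rfl
  have mZ : μ.real Z ≤ (n + p) * Real.exp (-L) := by
    have h := measureReal_norm_gt_le X q hlaw hind (fun i j => (√(w i))⁻¹ * (√(f j))⁻¹) M t hM ht0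
      ht1 (fun i j => by positivity)
      (fun i j => inv_sqrt_mul_inv_sqrt_le _ _ _ (hw i) (hf j) (hMw i) (hMf j))
      (fun i => sum_mul_inv_sqrt_sq_le _ _ _ _ lamW (fun j => (q (i, j)).2.1) hlamW (hw i) hf hMf
        hM.le rfl)
      (fun j => by
        simp only [mul_comm (√(w _))⁻¹]
        exact sum_mul_inv_sqrt_sq_le _ _ _ _ lamF (fun i => (q (i, j)).2.1) hlamF (hf j) hw hMw
          hM.le rfl)
    have e1 : t ^ 2 / (3 * M) = L := by rw [htL]; field_simp
    rw [e1] at h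
    refine le_trans (le_of_eq ?_) h
    congr 1
    ext ω
    have : DwInvSqrt m.expB lamW * (B ω - m.expB) * DfInvSqrt m.expB lamF
        = Matrix.of fun i j => (√(w i))⁻¹ * (√(f j))⁻¹ * (X (i, j) ω - q (i, j)) := by
      ext i j
      simp only [DwInvSqrt, DfInvSqrt, Matrix.diagonal_mul, Matrix.mul_diagonal, Matrix.of_apply,
        Matrix.sub_apply]
      change (√(w i))⁻¹ * (B ω i j - m.expB i j) * (√(f j))⁻¹
        = (√(w i))⁻¹ * (√(f j))⁻¹ * (B ω i j - m.expB i j)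
      ring
    simp only [hZ, Set.mem_ofPred_eq, this]
  set G : Set Ω := {ω | (∀ i j, 0 ≤ B ω i j) ∧
      (∀ i, |workerDegree (B ω) i - workerDegree m.expB i|
        < t * (workerDegree m.expB i + lamW)) ∧
      (∀ j, |firmDegree (B ω) j - firmDegree m.expB j| < t * (firmDegree m.expB j + lamF)) ∧
      ‖DwInvSqrt m.expB lamW * (B ω - m.expB) * DfInvSqrt m.expB lamF‖ ≤ t} with hG
  -- Covering the space and using subadditivity avoids complements, hence any measurability of the
  -- good event.
  have hcover : (Set.univ : Set Ω) ⊆ G ∪ (U ∪ ((⋃ i, W i) ∪ ((⋃ j, F j) ∪ Z))) := by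
    intro ω _
    by_contra hcon
    simp only [Set.mem_union, Set.mem_iUnion, not_or, not_exists] at hcon
    obtain ⟨h1, h2, h3, h4, h5⟩ := hcon
    exact h1 ⟨not_not.1 h2, fun i => not_le.1 (h3 i), fun j => not_le.1 (h4 j), not_lt.1 h5⟩
  have sW : μ.real (⋃ i, W i) ≤ n * (2 * Real.exp (-L)) := by
    refine (measureReal_iUnion_fintype_le _).trans ((Finset.sum_le_sum fun i _ => mW i).trans ?_)
    simp
  have sF : μ.real (⋃ j, F j) ≤ p * (2 * Real.exp (-L)) := by
    refine (measureReal_iUnion_fintype_le _).trans ((Finset.sum_le_sum fun i _ => mF i).trans ?_)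
    simp
  have h0 := measureReal_mono hcover (μ := μ)
  have h1 := measureReal_union_le (μ := μ) G (U ∪ ((⋃ i, W i) ∪ ((⋃ j, F j) ∪ Z)))
  have h2 := measureReal_union_le (μ := μ) U ((⋃ i, W i) ∪ ((⋃ j, F j) ∪ Z))
  have h3 := measureReal_union_le (μ := μ) (⋃ i, W i) ((⋃ j, F j) ∪ Z)
  have h4 := measureReal_union_le (μ := μ) (⋃ j, F j) Z
  rw [probReal_univ] at h0
  linarith

end Event

end RidgeNetwork

end

/-! ### Assembly of the firm and worker bounds -/

theorem mainTheorem3 {n p K : ℕ} (hK : 0 < K) (m : RidgeNetwork.BlockModel n p K)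
    {Ω : Type*} [MeasurableSpace Ω] (μ : Measure Ω) [IsProbabilityMeasure μ]
    (B : Ω → Matrix (Fin n) (Fin p) ℝ) (hB : m.IsNetwork μ B)
    (lamW lamF : ℝ) (hlamW : 0 ≤ lamW) (hlamF : 0 ≤ lamF)
    (hW : 0 < m.minW + lamW) (hF : 0 < m.minF + lamF)
    (ε : ℝ) (hε : 0 < ε) (M t γ : ℝ)
    (hM : M = max (m.minF + lamF)⁻¹ (m.minW + lamW)⁻¹)
    (hMle : M ≤ (3 * Real.log ((n + p : ℝ) / ε))⁻¹)
    (ht : t = √(3 * M * Real.log ((n + p : ℝ) / ε)))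
    (hγ : γ = (p : ℝ) / (n : ℝ)) :
    -- firm side
    (0 < lamF →
      IsUnit (RidgeNetwork.unnormLf m.expB lamW lamF).det ∧
      1 - (3 + 9 * γ) / (1 + γ) * ε ≤ μ.real {ω |
        IsUnit (RidgeNetwork.Dw (B ω) lamW).det ∧
        IsUnit (RidgeNetwork.unnormLf (B ω) lamW lamF).det ∧
        ‖(RidgeNetwork.unnormLf (B ω) lamW lamF)⁻¹
            - (RidgeNetwork.unnormLf m.expB lamW lamF)⁻¹‖
          = ‖RidgeNetwork.DfInvSqrt (B ω) lamF * (RidgeNetwork.normLf (B ω) lamW lamF)⁻¹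
                * RidgeNetwork.DfInvSqrt (B ω) lamF
              - RidgeNetwork.DfInvSqrt m.expB lamF * (RidgeNetwork.normLf m.expB lamW lamF)⁻¹
                * RidgeNetwork.DfInvSqrt m.expB lamF‖ ∧
        ‖(RidgeNetwork.unnormLf (B ω) lamW lamF)⁻¹
            - (RidgeNetwork.unnormLf m.expB lamW lamF)⁻¹‖
          ≤ (5 + 16 * ((m.maxF + lamF) / (m.minF + lamF)))
              * ((m.maxF + lamF) / lamF ^ 2) * t}) ∧
    -- worker side
    (0 < lamW →
      IsUnit (RidgeNetwork.unnormLw m.expB lamW lamF).det ∧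
      1 - (8 + 4 * γ) / (1 + γ) * ε ≤ μ.real {ω |
        IsUnit (RidgeNetwork.Df (B ω) lamF).det ∧
        IsUnit (RidgeNetwork.unnormLw (B ω) lamW lamF).det ∧
        ‖(RidgeNetwork.unnormLw (B ω) lamW lamF)⁻¹
            - (RidgeNetwork.unnormLw m.expB lamW lamF)⁻¹‖
          = ‖RidgeNetwork.DwInvSqrt (B ω) lamW * (RidgeNetwork.normLw (B ω) lamW lamF)⁻¹
                * RidgeNetwork.DwInvSqrt (B ω) lamW
              - RidgeNetwork.DwInvSqrt m.expB lamW * (RidgeNetwork.normLw m.expB lamW lamF)⁻¹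
                * RidgeNetwork.DwInvSqrt m.expB lamW‖ ∧
        ‖(RidgeNetwork.unnormLw (B ω) lamW lamF)⁻¹
            - (RidgeNetwork.unnormLw m.expB lamW lamF)⁻¹‖
          ≤ (5 + 16 * ((m.maxW + lamW) / (m.minW + lamW)))
              * ((m.maxW + lamW) / lamW ^ 2) * t}) := by
  open RidgeNetwork in
  have hp : 0 < p := by
    by_contra! h
    obtain rfl : p = 0 := by omega
    have := m.theta_sum ⟨0, hK⟩
    simp at this
  have hn : 0 < n := by
    obtain ⟨i, -⟩ := m.workerType_surjective ⟨0, hK⟩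
    exact i.pos
  have hN : (0 : ℝ) < n + p := by positivity
  have hminW : ∀ k, m.minW ≤ m.expWorkerDegree k := fun k => ciInf_le (Set.finite_range _).bddBelow k
  have hmaxW : ∀ k, m.expWorkerDegree k ≤ m.maxW := fun k => le_ciSup (Set.finite_range _).bddAbove k
  have hminF : ∀ j, m.minF ≤ m.expFirmDegree j := fun k => ciInf_le (Set.finite_range _).bddBelow k
  have hmaxF : ∀ j, m.expFirmDegree j ≤ m.maxF := fun k => le_ciSup (Set.finite_range _).bddAbove k
  have hWle : m.minW ≤ m.maxW := (hminW ⟨0, hK⟩).trans (hmaxW _)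
  have hFle : m.minF ≤ m.maxF := (hminF ⟨0, hp⟩).trans (hmaxF _)
  have hM0 : 0 < M := by rw [hM]; exact lt_max_of_lt_left (inv_pos.2 hF)
  have hMW : 1 ≤ M * (m.minW + lamW) := by
    rw [← inv_le_iff_one_le_mul₀ hW, hM]; exact le_max_right _ _
  have hMF : 1 ≤ M * (m.minF + lamF) := by
    rw [← inv_le_iff_one_le_mul₀ hF, hM]; exact le_max_left _ _
  have hwle : ∀ i, m.minW + lamW ≤ workerDegree m.expB i + lamW := fun i => by
    rw [m.workerDegree_expB]; linarith [hminW (m.workerType i)]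
  have hfle : ∀ j, m.minF + lamF ≤ firmDegree m.expB j + lamF := fun j => by
    rw [m.firmDegree_expB]; linarith [hminF j]
  have hw : ∀ i, 0 < workerDegree m.expB i + lamW := fun i => hW.trans_le (hwle i)
  have hf : ∀ j, 0 < firmDegree m.expB j + lamF := fun j => hF.trans_le (hfle j)
  set L := Real.log ((n + p : ℝ) / ε) with hLdef
  -- `M > 0` forces `(3 * L)⁻¹ > 0`, which also excludes `L = 0`, where the inverse is `0` by
  -- convention.
  have hL : 0 < L := by
    have := inv_pos.1 (hM0.trans_le hMle)
    linarith
  have h3ML : 3 * M * L ≤ 1 := by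
    have h1 := mul_le_mul_of_nonneg_right hMle (by positivity : 0 ≤ 3 * L)
    rw [inv_mul_cancel₀ (by positivity)] at h1
    linarith
  have ht0 : 0 ≤ t := by rw [ht]; positivity
  have ht1 : t ≤ 1 := by rw [ht]; exact Real.sqrt_le_one.2 h3ML
  have htL : t ^ 2 = 3 * M * L := by rw [ht, Real.sq_sqrt (by positivity)]
  have hexpL : (n + p : ℝ) * Real.exp (-L) = ε := by
    rw [Real.exp_neg, hLdef, Real.exp_log (by positivity)]
    field_simp
  have hgood := measureReal_good_event m B hB lamW lamF hlamW hlamF M t L hM0 hw hf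
    (fun i => hMW.trans (mul_le_mul_of_nonneg_left (hwle i) hM0.le))
    (fun j => hMF.trans (mul_le_mul_of_nonneg_left (hfle j) hM0.le)) ht0 ht1 hL.le htL
  rw [hexpL] at hgood
  have hγ0 : 0 ≤ γ := by rw [hγ]; positivity
  have hconst : ∀ a b : ℝ, 0 < a → a ≤ b → 21 ≤ 5 + 16 * (b / a) := by
    intro a b ha hab
    have := (one_le_div ha).2 hab
    linarith
  refine ⟨fun hlam => ⟨?_, ?_⟩, fun hlam => ⟨?_, ?_⟩⟩
  · exact isUnit_det_of_coercive _ _ hlam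
      (dotProduct_unnormLf_ge _ m.expB_nonneg lamW lamF hlamW hw)
  · have h1 : 3 ≤ (3 + 9 * γ) / (1 + γ) := by rw [le_div_iff₀ (by positivity)]; linarith
    refine le_trans (by nlinarith) (hgood.trans (measureReal_mono ?_))
    rintro ω ⟨hnn, hdw, hdf, hZ⟩
    obtain ⟨g1, g2, g3, g4⟩ := unnormLf_inv_sub_bound m.expB (B ω) m.expB_nonneg hnn lamW lamF hlamW
      hlam hw t (m.maxF + lamF) ht0 ht1 (by linarith)
      (fun j => by rw [m.firmDegree_expB]; linarith [hmaxF j]) hdw hdf hZ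
    refine ⟨g1, g2, g3, g4.trans ?_⟩
    refine mul_le_mul_of_nonneg_right (mul_le_mul_of_nonneg_right
      (hconst _ _ hF (by linarith)) ?_) ht0
    exact div_nonneg (by linarith) (by positivity)
  · exact isUnit_det_of_coercive _ _ hlam
      -- The worker Laplacian is definitionally the firm Laplacian of the transpose with the two
      -- ridges swapped.
      (dotProduct_unnormLf_ge m.expBᵀ (fun j i => m.expB_nonneg i j) lamF lamW hlamF hf)
  · have h1 : 3 ≤ (8 + 4 * γ) / (1 + γ) := by rw [le_div_iff₀ (by positivity)]; linarith
    refine le_trans (by nlinarith) (hgood.trans (measureReal_mono ?_))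
    rintro ω ⟨hnn, hdw, hdf, hZ⟩
    have hZt : ‖DwInvSqrt m.expBᵀ lamF * ((B ω)ᵀ - m.expBᵀ) * DfInvSqrt m.expBᵀ lamW‖ ≤ t := by
      rw [← l2_opNorm_transpose, Matrix.transpose_mul, Matrix.transpose_mul, DwInvSqrt, DfInvSqrt,
        Matrix.diagonal_transpose, Matrix.diagonal_transpose, ← Matrix.mul_assoc]
      exact hZ
    obtain ⟨g1, g2, g3, g4⟩ := unnormLf_inv_sub_bound m.expBᵀ (B ω)ᵀ
      (fun j i => m.expB_nonneg i j) (fun j i => hnn i j) lamF lamW hlamF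
      hlam hf t (m.maxW + lamW) ht0 ht1 (by linarith)
      (fun i => by
        change workerDegree m.expB i + lamW ≤ _
        rw [m.workerDegree_expB]; linarith [hmaxW (m.workerType i)]) hdf hdw hZt
    refine ⟨g1, g2, g3, g4.trans ?_⟩
    refine mul_le_mul_of_nonneg_right (mul_le_mul_of_nonneg_right
      (hconst _ _ hW (by linarith)) ?_) ht0
    exact div_nonneg (by linarith) (by positivity)
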